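/- **Proposition.** Work in the complex projective plane. A Cremona transformation is a birational map $\gamma\colon\mathbb P^2\dashrightarrow\mathbb P^2$. A reduced plane curve $C$ is *Cremona contractible* (Cr-contractible) if there is a Cremona transformation that contracts $C$ to a set of points, i.e. that is constant on each irreducible component of $C$. Let $C=L_1\cup\cdots\cup L_9$ be a union of nine distinct lines of type $(9;6,3,2^{18})$, i.e. with one point of multiplicity $6$, one point of multiplicity $3$ and $18$ nodes as its only singular points. 1. If the line joining the $6$-fold point and the triple point is a component of $C$, i.e. if, after relabelling, $C$ has the configuration $(9;\{1,2,3,4,5,6\},\{1,7,8\})$ (the $6$-fold point is $L_1\cap\cdots\cap L_6$ and the triple point is $L_1\cap L_7\cap L_8$), then $C$ is Cr-contractible. 2. By contrast, if $C$ has the other configuration of the same type, $(9;\{1,2,3,4,5,6\},\{7,8,9\})$ (the $6$-fold point is $L_1\cap\cdots\cap L_6$ and the triple point is $L_7\cap L_8\cap L_9$), then $\mathrm{ad}_{2,3}(C)\neq\emptyset$. Here $\mathrm{ad}_{2,3}(C)=f_*|2\tilde C+3K_S|$, where $f\colon S\to\mathbb P^2$ is the blow-up of the singular points of $C$ and $\tilde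 C$ is the strict transform of $C$. Explicitly, $\mathrm{ad}_{2,3}(C)$ is the linear system of plane curves of degree $9$ that have multiplicity at least $9$ at the $6$-fold point, at least $3$ at the triple point, and that pass through the $18$ nodes. -/

import Mathlib

open MvPolynomial
open scoped LinearAlgebra.Projectivization

/-- The complex projective plane. -/
abbrev Plane : Type := ℙ ℂ (Fin 3 → ℂ)

/-- Lines of the plane, given by their dual coordinates `[a₀ : a₁ : a₂]`. -/
abbrev PlaneLine : Type := ℙ ℂ (Fin 3 → ℂ)

/-- The point `P` lies on the line `ℓ`, i.e. `a₀ x₀ + a₁ x₁ + a₂ x₂ = 0`. -/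
def PlaneLine.Through (ℓ : PlaneLine) (P : Plane) : Prop :=
  Projectivization.orthogonal ℓ P

/-- A linear form whose zero locus is the line `ℓ` (well defined up to a nonzero scalar). -/
noncomputable def PlaneLine.equation (ℓ : PlaneLine) : MvPolynomial (Fin 3) ℂ :=
  ∑ i, C (ℓ.rep i) * X i

/-- A Cremona transformation of the complex projective plane: a rational self-map
`[x] ↦ [f₀(x) : f₁(x) : f₂(x)]`, given by three forms of the same degree without common
factor, which has a rational inverse. -/
structure CremonaMap where
  /-- the degree of the transformation -/
  degree : ℕ
  /-- the three forms -/
  form : Fin 3 → MvPolynomial (Fin 3) ℂ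
  isHomogeneous : ∀ i, (form i).IsHomogeneous degree
  coprime : ∀ p : MvPolynomial (Fin 3) ℂ, (∀ i, p ∣ form i) → IsUnit p
  /-- There is a rational map `[x] ↦ [g₀(x) : g₁(x) : g₂(x)]` such that both composites are the
  identity as rational maps. -/
  birational : ∃ (e : ℕ) (g : Fin 3 → MvPolynomial (Fin 3) ℂ),
    (∀ i, (g i).IsHomogeneous e) ∧
    (∃ h : MvPolynomial (Fin 3) ℂ, h ≠ 0 ∧ ∀ i, bind₁ form (g i) = h * X i) ∧
    (∃ h : MvPolynomial (Fin 3) ℂ, h ≠ 0 ∧ ∀ i, bind₁ g (form i) = h * X i)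

/-- The values of the three forms of a Cremona transformation at a vector `v`. The
transformation is defined at the point `[v]` if and only if this vector is nonzero. -/
noncomputable def CremonaMap.value (γ : CremonaMap) (v : Fin 3 → ℂ) : Fin 3 → ℂ :=
  fun i => eval v (γ.form i)

/-- The Cremona transformation `γ` contracts the irreducible curve `p = 0` to a point: it is
constant on the set of the points of the curve at which it is defined. (This set is dense in the
curve, since `p` does not divide all three forms of `γ`.) -/
def CremonaMap.Contracts (γ : CremonaMap) (p : MvPolynomial (Fin 3) ℂ) : Prop :=
  ∃ Q : Plane, ∀ v : Fin 3 → ℂ, v ≠ 0 → eval v p = 0 →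
    ∀ h : γ.value v ≠ 0, Projectivization.mk ℂ (γ.value v) h = Q

/-- The plane curve `G = 0`, where `G` is a squarefree form, is Cremona contractible: some Cremona
transformation contracts it to a set of points, i.e. contracts each of its irreducible
components to a point. -/
def CrContractible (G : MvPolynomial (Fin 3) ℂ) : Prop :=
  ∃ γ : CremonaMap, ∀ p : MvPolynomial (Fin 3) ℂ, Irreducible p → p ∣ G → γ.Contracts p

/-- The equation of the union of the lines `L i`. -/
noncomputable def unionOfLines {d : ℕ} (L : Fin d → PlaneLine) : MvPolynomial (Fin 3) ℂ :=
  ∏ i, (L i).equation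

/-- The lines `L i` are distinct and `B` is the list of the sets of (indices of) lines of the family
through the points of multiplicity at least three of their union: a set `I` with at least three
elements is in `B` if and only if it is the set of all the lines of the family through some
point. All the other singular points of the union are nodes. -/
def HasConfiguration {d : ℕ} (L : Fin d → PlaneLine) (B : Finset (Finset (Fin d))) : Prop :=
  Function.Injective L ∧
    ∀ I : Finset (Fin d),
      I ∈ B ↔ 3 ≤ I.card ∧ ∃ P : Plane, ∀ i, i ∈ I ↔ (L i).Through P

/-- The multiplicity at `P` of the union of the distinct lines `L i`. -/
noncomputable def lineMultiplicity {d : ℕ} (L : Fin d → PlaneLine) (P : Plane) : ℕ :=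
  {i | (L i).Through P}.ncard

/-- The form `F` has multiplicity at least `k` at the point `P`: it lies in the `k`-th power of
the maximal ideal of a representative of `P` (i.e. the cone over the curve `F = 0`, which is locally
the product of the curve and a line, has multiplicity at least `k` there). -/
def HasMultiplicityAtLeast (F : MvPolynomial (Fin 3) ℂ) (P : Plane) (k : ℕ) : Prop :=
  F ∈ RingHom.ker (eval P.rep) ^ k

/-- The `(n, m)`-adjoint linear system, for `m ≥ n ≥ 1`, to the union `C` of `d` distinct
lines, as the set of the equations of its members. Blowing up the singular points of `C` gives
`f : S → ℙ²` that resolves the singularities, as these are ordinary. With `H` the class of a line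
and `E_P` the exceptional curves, the strict transform of `C` is `d H - ∑ m_P E_P` and `K_S` is
`-3 H + ∑ E_P`. So `f_* |n C' + m K_S|` consists of the curves of degree `n d - 3 m` with
multiplicity at least `n m_P - m` at each `P` (truncated at `0`; no condition if `m_P ≤ 1`). -/
def adjointSystem {d : ℕ} (n m : ℕ) (L : Fin d → PlaneLine) :
    Set (MvPolynomial (Fin 3) ℂ) :=
  {F | F ≠ 0 ∧ (∃ k : ℕ, k + 3 * m = n * d ∧ F.IsHomogeneous k) ∧
    ∀ P : Plane, HasMultiplicityAtLeast F P (n * lineMultiplicity L P - m)}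

/-! Contractibility. In suitable affine coordinates `ξ = ex / ez`, `η = ey / ez` the nine lines are
the joining line `ez = 0`, five fibres `ξ = aᵢ` and the sections `η = 0`, `η = 1`, `η = ξ`
(`exists_normalLines`); the absence of other triple points gives `aᵢ ≠ 0, 1`. A Möbius change `x` of
`ξ` and a Möbius change `w` of `η` over `ℂ(ξ)` move the fibres to `x = ∞, 0, p, q, r` and the
sections to `w = 0, ∞, 1`, and crush `ez = 0` to the point `x = w = 1`.

The heart is a function `U = rulingParam` of `x` and `w` that is `0` or `∞` along eight of the
lines, while along the line of index `7` (`η = 1`, `w = ∞`) it restricts to `-1 / (x - q)`, so that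
this line is a section of the pencil `U = const`. If `t` is the quotient of the two members
`conicMember p q r` and `conicMember r q p`, then `x` and `w` are rational functions of `U` and `t`
(`mem_of_ruling_mem`). The function `W = fibreParam`, affine in `t` over `ℂ(U)`, vanishes along the
section, and `R = U / (1 + U) ^ 2` vanishes along the other eight lines and is a unit along the
section.

Hence for large `n` both `φ = U W Rⁿ` and `ψ = W Rⁿ` vanish along all nine lines. They generate the
function field, because `U = φ / ψ` and `W = ψ / Rⁿ`. So `[1 : φ : ψ]` is a Cremona transformation
(`exists_cremonaMap`) that contracts every line to `[1 : 0 : 0]` (`exists_cremonaMap_normalLines`).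
Vanishing along a line is measured by the valuation of its linear form on the fraction field of the
polynomial ring; the function field of the plane is the `ratioField` of the coordinates.

Adjoint system. The six lines through the 6-fold point together with three times the line joining it
to the triple point form a curve of degree `9` with the required multiplicities; it passes through
every node because the other three lines meet one another only at the triple point. -/

namespace MvPolynomial

/-! ### Forms, their factors, and linear forms -/

/-- Euler scaling for homogeneous polynomials. -/
lemma IsHomogeneous.aeval_mul_const {σ A : Type*} [CommRing A] [Algebra ℂ A]
    {p : MvPolynomial σ ℂ} {n : ℕ} (hp : p.IsHomogeneous n) (c : A) (w : σ → A) :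
    MvPolynomial.aeval (fun i => c * w i) p = c ^ n * MvPolynomial.aeval w p := by
  rw [aeval_def, aeval_def, eval₂_eq, eval₂_eq, Finset.mul_sum]
  refine Finset.sum_congr rfl fun d hd => ?_
  have hdn : ∑ i ∈ d.support, d i = n := by
    have := hp (mem_support_iff.1 hd)
    rw [Finsupp.weight_apply, Finsupp.sum] at this
    simpa using this
  simp_rw [mul_pow]
  rw [Finset.prod_mul_distrib, Finset.prod_pow_eq_pow_sum, hdn]
  ring

/-- The polynomial `p(TX)` in one more variable `T`, which records the homogeneous components. -/
noncomputable def scaleHom : MvPolynomial (Fin 3) ℂ →ₐ[ℂ] Polynomial (MvPolynomial (Fin 3) ℂ) :=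
  MvPolynomial.aeval fun i => Polynomial.X * Polynomial.C (X i)

lemma scaleHom_of_isHomogeneous {p : MvPolynomial (Fin 3) ℂ} {n : ℕ} (hp : p.IsHomogeneous n) :
    scaleHom p = Polynomial.X ^ n * Polynomial.C p := by
  rw [scaleHom, hp.aeval_mul_const]
  congr 1
  have : (MvPolynomial.aeval fun i => Polynomial.C (X i : MvPolynomial (Fin 3) ℂ)) =
      (Polynomial.CAlgHom : MvPolynomial (Fin 3) ℂ →ₐ[ℂ] _) := by
    ext i; simp
  rw [this]; rfl

lemma coeff_scaleHom (p : MvPolynomial (Fin 3) ℂ) (n : ℕ) :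
    (scaleHom p).coeff n = homogeneousComponent n p := by
  conv_lhs => rw [← sum_homogeneousComponent p]
  rw [map_sum, Polynomial.finsetSum_coeff]
  simp_rw [scaleHom_of_isHomogeneous (homogeneousComponent_isHomogeneous _ _),
    Polynomial.coeff_X_pow_mul', Polynomial.coeff_C]
  by_cases h : n < p.totalDegree + 1
  · rw [Finset.sum_eq_single_of_mem n (Finset.mem_range.2 h)]
    · simp
    · intro b _ hb
      split_ifs with h1 h2
      · omega
      · rfl
      · rfl
  · rw [homogeneousComponent_eq_zero _ _ (by omega)]
    refine Finset.sum_eq_zero fun b hb => ?_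
    have := Finset.mem_range.1 hb
    split_ifs with h1 h2
    · omega
    · rfl
    · rfl

/-- The factors of a nonzero form are forms. -/
lemma IsHomogeneous.of_mul_left {p q : MvPolynomial (Fin 3) ℂ} {n : ℕ}
    (h : (p * q).IsHomogeneous n) (h0 : p * q ≠ 0) :
    ∃ k, p.IsHomogeneous k ∧ k ≤ n := by
  have hs := scaleHom_of_isHomogeneous h
  rw [map_mul] at hs
  have inj : ∀ f : MvPolynomial (Fin 3) ℂ, f ≠ 0 → scaleHom f ≠ 0 := by
    intro f hf h
    apply hf
    rw [← sum_homogeneousComponent f]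
    exact Finset.sum_eq_zero fun i _ => by rw [← coeff_scaleHom, h, Polynomial.coeff_zero]
  have hp := inj p (left_ne_zero_of_mul h0)
  have hq := inj q (right_ne_zero_of_mul h0)
  have hC : Polynomial.C (p * q) ≠ 0 := by simpa using h0
  -- Degree and trailing degree in `T` are both additive, and they agree for the monomial `T ^ n * C
  -- (p * q)`; hence they agree for each factor.
  have d1 := congrArg Polynomial.natDegree hs
  have d2 := congrArg Polynomial.natTrailingDegree hs
  rw [Polynomial.natDegree_mul hp hq, Polynomial.natDegree_mul (by simp) hC,
    Polynomial.natDegree_X_pow, Polynomial.natDegree_C] at d1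
  rw [Polynomial.natTrailingDegree_mul hp hq, Polynomial.natTrailingDegree_mul (by simp) hC,
    Polynomial.natTrailingDegree_X_pow, Polynomial.natTrailingDegree_C] at d2
  have e1 := Polynomial.natTrailingDegree_le_natDegree (scaleHom p)
  have e2 := Polynomial.natTrailingDegree_le_natDegree (scaleHom q)
  refine ⟨(scaleHom p).natDegree, ?_, by omega⟩
  have : p = homogeneousComponent (scaleHom p).natDegree p := by
    conv_lhs => rw [← sum_homogeneousComponent p]
    have key : ∀ i, i ≠ (scaleHom p).natDegree → homogeneousComponent i p = 0 := by
      intro i hi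
      rw [← coeff_scaleHom]
      rcases lt_or_gt_of_ne hi with h | h
      · exact Polynomial.coeff_eq_zero_of_lt_natTrailingDegree (by omega)
      · exact Polynomial.coeff_eq_zero_of_natDegree_lt h
    by_cases hm : (scaleHom p).natDegree ∈ Finset.range (p.totalDegree + 1)
    · exact Finset.sum_eq_single_of_mem _ hm fun i _ hi => key i hi
    · refine absurd (Polynomial.leadingCoeff_eq_zero.1 ?_) hp
      rw [Polynomial.leadingCoeff, coeff_scaleHom,
        homogeneousComponent_eq_zero _ _ (by simpa using hm)]
  have h2 := homogeneousComponent_isHomogeneous (scaleHom p).natDegree p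
  rwa [← this] at h2

/-- The linear form with coefficients `a`. -/
noncomputable def linForm (a : Fin 3 → ℂ) : MvPolynomial (Fin 3) ℂ := ∑ i, C (a i) * X i

lemma linForm_isHomogeneous (a : Fin 3 → ℂ) : (linForm a).IsHomogeneous 1 :=
  IsHomogeneous.sum _ _ _ fun _ _ => isHomogeneous_C_mul_X _ _

lemma linForm_smul (c : ℂ) (a : Fin 3 → ℂ) : linForm (c • a) = C c * linForm a := by
  simp [linForm, Finset.mul_sum, mul_assoc]

lemma linForm_add (a b : Fin 3 → ℂ) : linForm (a + b) = linForm a + linForm b := by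
  simp [linForm, add_mul, Finset.sum_add_distrib]

lemma linForm_sub (a b : Fin 3 → ℂ) : linForm (a - b) = linForm a - linForm b := by
  simp [linForm, sub_mul, Finset.sum_sub_distrib]

lemma eval_linForm (v a : Fin 3 → ℂ) : eval v (linForm a) = a ⬝ᵥ v := by
  simp [linForm, dotProduct]

lemma linForm_eq_zero {a : Fin 3 → ℂ} : linForm a = 0 ↔ a = 0 := by
  refine ⟨fun h => ?_, fun h => by simp [h, linForm]⟩
  rw [← dotProduct_eq_zero_iff]
  intro w
  rw [← eval_linForm, h, map_zero]

lemma linForm_injective : Function.Injective linForm := by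
  intro a b h
  rw [← sub_eq_zero, ← linForm_sub, linForm_eq_zero] at h
  exact sub_eq_zero.1 h

lemma linForm_irreducible {a : Fin 3 → ℂ} (ha : a ≠ 0) : Irreducible (linForm a) := by
  have h0 : linForm a ≠ 0 := linForm_eq_zero.not.2 ha
  refine irreducible_of_totalDegree_eq_one ((linForm_isHomogeneous a).totalDegree h0) ?_
  intro x hx
  obtain ⟨d, hd⟩ := ne_zero_iff.1 h0
  rw [isUnit_iff_ne_zero]
  rintro rfl
  exact hd (zero_dvd_iff.1 (hx d))

lemma linForm_prime {a : Fin 3 → ℂ} (ha : a ≠ 0) : Prime (linForm a) :=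
  (linForm_irreducible ha).prime

lemma linForm_dvd_linForm {a b : Fin 3 → ℂ} (hb : b ≠ 0) (h : linForm a ∣ linForm b) :
    ∃ c : ℂ, b = c • a := by
  obtain ⟨q, hq⟩ := h
  have hb0 : linForm b ≠ 0 := linForm_eq_zero.not.2 hb
  have hne : linForm a * q ≠ 0 := hq ▸ hb0
  have ht := congrArg totalDegree hq
  rw [(linForm_isHomogeneous b).totalDegree hb0,
    totalDegree_mul_of_isDomain (left_ne_zero_of_mul hne) (right_ne_zero_of_mul hne),
    (linForm_isHomogeneous a).totalDegree (left_ne_zero_of_mul hne)] at ht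
  have hq0 : q.totalDegree = 0 := by omega
  rw [totalDegree_eq_zero_iff_eq_C] at hq0
  refine ⟨coeff 0 q, linForm_injective ?_⟩
  rw [linForm_smul, ← hq0, hq, mul_comm]

end MvPolynomial

/-! ### The valuation of a prime element -/

lemma algebraMap_ne_zero_of_not_dvd {R K : Type*} [CommRing R] [Field K] [Algebra R K]
    [IsFractionRing R K] {π b : R} (hb : ¬ π ∣ b) : algebraMap R K b ≠ 0 := by
  intro h
  exact hb ((IsFractionRing.injective R K (by rw [h, map_zero]) : b = 0) ▸ dvd_zero π)

section PrimeValuation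

variable {R K : Type*} [CommRing R] [IsDomain R] [UniqueFactorizationMonoid R] [Field K]
  [Algebra R K] [IsFractionRing R K]

/-- The valuation ring of a prime element of a factorial domain. -/
noncomputable def primeValuationSubring (K : Type*) [Field K] [Algebra R K] [IsFractionRing R K]
    {π : R} (hπ : Prime π) : ValuationSubring K where
  carrier := {f | ∃ a b : R, ¬ π ∣ b ∧ f * algebraMap R K b = algebraMap R K a}
  mul_mem' := by
    rintro f g ⟨a, b, hb, h⟩ ⟨a', b', hb', h'⟩
    refine ⟨a * a', b * b', fun hd => (hπ.dvd_or_dvd hd).elim hb hb', ?_⟩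
    rw [map_mul, map_mul, ← h, ← h']; ring
  one_mem' := ⟨1, 1, fun h => hπ.not_isUnit (isUnit_of_dvd_one h), by simp⟩
  add_mem' := by
    rintro f g ⟨a, b, hb, h⟩ ⟨a', b', hb', h'⟩
    refine ⟨a * b' + a' * b, b * b', fun hd => (hπ.dvd_or_dvd hd).elim hb hb', ?_⟩
    rw [map_add, map_mul, map_mul, map_mul, ← h, ← h']; ring
  zero_mem' := ⟨0, 1, fun h => hπ.not_isUnit (isUnit_of_dvd_one h), by simp⟩
  neg_mem' := by
    rintro f ⟨a, b, hb, h⟩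
    exact ⟨-a, b, hb, by rw [map_neg, ← h]; ring⟩
  mem_or_inv_mem' := by
    intro f
    -- In a reduced fraction `π` divides at most one of the two terms.
    obtain ⟨a, b, hab, rfl⟩ := IsFractionRing.exists_reduced_fraction R f
    by_cases hb : π ∣ (b : R)
    · right
      have ha : ¬ π ∣ a := fun ha => hπ.not_isUnit (hab ha hb)
      have ha0 : algebraMap R K a ≠ 0 := by
        intro h
        exact ha ((IsFractionRing.injective R K (by rw [h, map_zero]) : a = 0) ▸ dvd_zero π)
      refine ⟨b, a, ha, ?_⟩
      rw [IsFractionRing.mk'_eq_div]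
      field_simp
    · left
      exact ⟨a, b, hb, IsLocalization.mk'_spec K a b⟩

variable {π : R} (hπ : Prime π)

lemma mem_primeValuationSubring {f : K} : f ∈ primeValuationSubring K hπ ↔
    ∃ a b : R, ¬ π ∣ b ∧ f * algebraMap R K b = algebraMap R K a := Iff.rfl

lemma primeValuation_algebraMap_le_one (a : R) :
    (primeValuationSubring K hπ).valuation (algebraMap R K a) ≤ 1 := by
  rw [ValuationSubring.valuation_le_one_iff]
  exact ⟨a, 1, fun h => hπ.not_isUnit (isUnit_of_dvd_one h), by simp⟩

lemma primeValuation_algebraMap_eq_one {b : R} (hb : ¬ π ∣ b) :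
    (primeValuationSubring K hπ).valuation (algebraMap R K b) = 1 := by
  have h0 : algebraMap R K b ≠ 0 := algebraMap_ne_zero_of_not_dvd hb
  refine le_antisymm (primeValuation_algebraMap_le_one hπ b) ?_
  have : (primeValuationSubring K hπ).valuation (algebraMap R K b)⁻¹ ≤ 1 := by
    rw [ValuationSubring.valuation_le_one_iff]
    exact ⟨1, b, hb, by rw [inv_mul_cancel₀ h0, map_one]⟩
  rw [map_inv₀] at this
  exact (inv_le_one₀ (by simpa [zero_lt_iff] using h0)).1 this

lemma primeValuation_self_lt_one :
    (primeValuationSubring K hπ).valuation (algebraMap R K π) < 1 := by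
  have h0 : algebraMap R K π ≠ 0 := by
    intro h
    exact hπ.ne_zero (IsFractionRing.injective R K (by rw [h, map_zero]))
  by_contra! h
  have h1 : (primeValuationSubring K hπ).valuation (algebraMap R K π)⁻¹ ≤ 1 := by
    rw [map_inv₀]; exact inv_le_one_of_one_le₀ h
  rw [ValuationSubring.valuation_le_one_iff] at h1
  obtain ⟨a, b, hb, hab⟩ := h1
  apply hb
  refine ⟨a, IsFractionRing.injective R K ?_⟩
  rw [map_mul, ← hab]; field_simp

lemma primeValuation_lt_one_iff {f : K} : (primeValuationSubring K hπ).valuation f < 1 ↔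
    ∃ a b : R, ¬ π ∣ b ∧ π ∣ a ∧ f * algebraMap R K b = algebraMap R K a := by
  constructor
  · intro h
    obtain ⟨a, b, hb, hab⟩ := (mem_primeValuationSubring hπ).1
      ((ValuationSubring.valuation_le_one_iff _ _).1 h.le)
    refine ⟨a, b, hb, ?_, hab⟩
    by_contra ha
    have := congrArg (primeValuationSubring K hπ).valuation hab
    rw [map_mul, primeValuation_algebraMap_eq_one hπ hb, primeValuation_algebraMap_eq_one hπ ha,
      mul_one] at this
    exact h.ne this
  · rintro ⟨a, b, hb, ⟨c, rfl⟩, h⟩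
    have := congrArg (primeValuationSubring K hπ).valuation h
    rw [map_mul, primeValuation_algebraMap_eq_one hπ hb, mul_one, map_mul, map_mul] at this
    rw [this]
    exact mul_lt_one_of_lt_of_le (primeValuation_self_lt_one hπ)
      (primeValuation_algebraMap_le_one hπ c)

/-- The valuation is discrete: an element of the maximal ideal is `π` times an integral one, so the
value of `π` is the largest below `1`. -/
lemma primeValuation_lt_one_imp_le {f : K} (hf : (primeValuationSubring K hπ).valuation f < 1) :
    (primeValuationSubring K hπ).valuation f ≤
      (primeValuationSubring K hπ).valuation (algebraMap R K π) := by
  obtain ⟨a, b, hb, ⟨c, rfl⟩, h⟩ := (primeValuation_lt_one_iff hπ).1 hf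
  have := congrArg (primeValuationSubring K hπ).valuation h
  rw [map_mul, primeValuation_algebraMap_eq_one hπ hb, mul_one, map_mul, map_mul] at this
  rw [this]
  exact mul_le_of_le_one_right' (primeValuation_algebraMap_le_one hπ c)

/-- The valuation of a prime element is archimedean. -/
lemma exists_primeValuation_mul_pow_lt_one (f : K) {g : K}
    (hg : (primeValuationSubring K hπ).valuation g < 1) :
    ∃ N : ℕ, ∀ n ≥ N, (primeValuationSubring K hπ).valuation (f * g ^ n) < 1 := by
  obtain ⟨a, b, hb, rfl⟩ := IsFractionRing.div_surjective (A := R) f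
  have hb0 : b ≠ 0 := nonZeroDivisors.ne_zero hb
  obtain ⟨c, hc, hd⟩ := (FiniteMultiplicity.of_prime_left hπ hb0).exists_eq_pow_mul_and_not_dvd
  set k := multiplicity π b
  set v := (primeValuationSubring K hπ).valuation
  have hπ0 : v (algebraMap R K π) ≠ 0 := by
    rw [Ne, map_eq_zero]
    exact fun h => hπ.ne_zero (IsFractionRing.injective R K (by rw [h, map_zero]))
  have hπ1 : v (algebraMap R K π) < 1 := primeValuation_self_lt_one hπ
  -- `k` bounds the order of the pole of `f`; the extra `1` makes the inequality strict.
  refine ⟨k + 1, fun n hn => ?_⟩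
  have h1 : v (algebraMap R K b) = v (algebraMap R K π) ^ k := by
    rw [hc, map_mul, map_mul, map_pow, map_pow,
      show v (algebraMap R K c) = 1 from primeValuation_algebraMap_eq_one hπ hd, mul_one]
  rw [map_mul, map_div₀, map_pow, h1]
  have h2 : v g ^ n ≤ v (algebraMap R K π) ^ (k + 1) :=
    (pow_le_pow_left' (primeValuation_lt_one_imp_le hπ hg) n).trans
      (pow_le_pow_right_of_le_one' hπ1.le hn)
  calc _ ≤ v (algebraMap R K a) / v (algebraMap R K π) ^ k * v (algebraMap R K π) ^ (k + 1) :=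
        mul_le_mul_right h2 _
    _ = v (algebraMap R K a) * v (algebraMap R K π) := by
        rw [pow_succ]; field_simp
    _ < 1 := by
        rw [mul_comm]
        exact mul_lt_one_of_lt_of_le hπ1 (primeValuation_algebraMap_le_one hπ a)

end PrimeValuation

/-! ### Fields of rational functions of degree zero -/

section RatioField

variable {K : Type*} [Field K] [Algebra ℂ K]

/-- The field of the values at `w` of the rational functions of degree zero. -/
noncomputable def ratioField (w : Fin 3 → K) : IntermediateField ℂ K :=
  Subfield.toIntermediateField
    { carrier := {f | ∃ (n : ℕ) (A B : MvPolynomial (Fin 3) ℂ), A.IsHomogeneous n ∧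
        B.IsHomogeneous n ∧ aeval w B ≠ 0 ∧ f * aeval w B = aeval w A}
      mul_mem' := by
        rintro f g ⟨n, A, B, hA, hB, h0, h⟩ ⟨m, A', B', hA', hB', h0', h'⟩
        refine ⟨n + m, A * A', B * B', hA.mul hA', hB.mul hB', ?_, ?_⟩
        · rw [map_mul]; exact mul_ne_zero h0 h0'
        · rw [map_mul, map_mul, ← h, ← h']; ring
      one_mem' := ⟨0, 1, 1, isHomogeneous_one _ _, isHomogeneous_one _ _, by simp, by simp⟩
      add_mem' := by
        rintro f g ⟨n, A, B, hA, hB, h0, h⟩ ⟨m, A', B', hA', hB', h0', h'⟩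
        refine ⟨n + m, A * B' + B * A', B * B', (hA.mul hB').add (hB.mul hA'), hB.mul hB', ?_, ?_⟩
        · rw [map_mul]; exact mul_ne_zero h0 h0'
        · rw [map_mul, map_add, map_mul, map_mul, ← h, ← h']; ring
      zero_mem' := ⟨0, 0, 1, isHomogeneous_zero _ _ _, isHomogeneous_one _ _, by simp, by simp⟩
      neg_mem' := by
        rintro f ⟨n, A, B, hA, hB, h0, h⟩
        exact ⟨n, -A, B, hA.neg, hB, h0, by rw [map_neg, ← h]; ring⟩
      inv_mem' := by
        rintro f ⟨n, A, B, hA, hB, h0, h⟩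
        by_cases hf : f = 0
        · exact ⟨0, 0, 1, isHomogeneous_zero _ _ _, isHomogeneous_one _ _, by simp, by simp [hf]⟩
        · refine ⟨n, B, A, hB, hA, ?_, ?_⟩
          · rw [← h]; exact mul_ne_zero hf h0
          · rw [← h]; field_simp }
    (fun c => ⟨0, C c, 1, isHomogeneous_C _ _, isHomogeneous_one _ _, by simp, by simp⟩)

lemma mem_ratioField {w : Fin 3 → K} {f : K} : f ∈ ratioField w ↔
    ∃ (n : ℕ) (A B : MvPolynomial (Fin 3) ℂ), A.IsHomogeneous n ∧
        B.IsHomogeneous n ∧ aeval w B ≠ 0 ∧ f * aeval w B = aeval w A := Iff.rfl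

end RatioField

/-! ### Cremona transformations from generators of the function field -/

lemma exists_isRelPrime_factors {R : Type*} [CommRing R] [IsDomain R]
    [UniqueFactorizationMonoid R] (F : Fin 3 → R) (h0 : F 0 ≠ 0) :
    ∃ (G : R) (f : Fin 3 → R), (∀ i, F i = G * f i) ∧ ∀ p, (∀ i, p ∣ f i) → IsUnit p := by
  -- Two successive greatest common divisors: `c` of `F 0` and `F 1`, then `c'` of `c` and `F 2`.
  obtain ⟨a, b, c, hab, hF0, hF1⟩ := UniqueFactorizationMonoid.exists_reduced_factors (F 0) h0 (F 1)
  have hc : c ≠ 0 := by rintro rfl; simp at hF0; exact h0 hF0.symm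
  obtain ⟨a', b', c', hab', hc0, hF2⟩ :=
    UniqueFactorizationMonoid.exists_reduced_factors c hc (F 2)
  refine ⟨c', ![a * a', b * a', b'], ?_, ?_⟩
  · intro i
    fin_cases i
    · simp only [Fin.zero_eta, Matrix.cons_val_zero]; rw [← hF0, ← hc0]; ring
    · simp only [Fin.mk_one, Matrix.cons_val_one, Matrix.cons_val_zero]; rw [← hF1, ← hc0]; ring
    · simp only [Fin.reduceFinMk, Matrix.cons_val]; rw [← hF2]
  · intro p hp
    have h0 : p ∣ a * a' := hp 0
    have h1 : p ∣ b * a' := hp 1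
    have h2 : p ∣ b' := hp 2
    have hpa : IsRelPrime p a' := fun d hd hda => hab' hda (hd.trans h2)
    exact hab (hpa.dvd_of_dvd_mul_right h0) (hpa.dvd_of_dvd_mul_right h1)

abbrev PolyRing : Type := MvPolynomial (Fin 3) ℂ

/-- The function field of the affine cone over the plane. -/
abbrev ConeField : Type := FractionRing (MvPolynomial (Fin 3) ℂ)

/-- A triple of forms of positive degree with a one-sided rational inverse is algebraically
independent. -/
lemma algebraicIndependent_of_inverse {d : ℕ} {f g : Fin 3 → MvPolynomial (Fin 3) ℂ}
    (hf : ∀ i, (f i).IsHomogeneous d) (hd : d ≠ 0) (hf0 : f 0 ≠ 0)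
    {h : MvPolynomial (Fin 3) ℂ} (h0 : h ≠ 0) (hgf : ∀ i, bind₁ f (g i) = h * X i) :
    AlgebraicIndependent ℂ f := by
  set S := Algebra.adjoin ℂ (Set.range f)
  have mem : ∀ p : MvPolynomial (Fin 3) ℂ, bind₁ f p ∈ S := by
    intro p
    rw [← aeval_eq_bind₁]
    simp only [S, Algebra.adjoin_range_eq_range_aeval]
    exact ⟨p, rfl⟩
  -- Since `f 0 ∘ g ∘ f = f 0 (h X) = h ^ d * f 0`, the power `h ^ d` is a quotient of two elements
  -- of `S`. As `d > 0`, `h` is algebraic, and then so is each `X i = g i (f) / h`.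
  have halg : IsAlgebraic S h := by
    have key : bind₁ f (bind₁ g (f 0)) = h ^ d * f 0 := by
      rw [bind₁_bind₁]
      simp_rw [hgf]
      rw [← aeval_eq_bind₁, (hf 0).aeval_mul_const, aeval_X_left]; rfl
    have hfS : f 0 ∈ S := Algebra.subset_adjoin ⟨0, rfl⟩
    have : IsAlgebraic S (h ^ d) := by
      refine ⟨Polynomial.C ⟨f 0, hfS⟩ * Polynomial.X - Polynomial.C ⟨_, mem (bind₁ g (f 0))⟩, ?_, ?_⟩
      · intro hz
        have := congrArg (fun q => Polynomial.coeff q 1) hz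
        simp at this
        exact hf0 (congrArg Subtype.val this)
      · simp only [map_sub, map_mul, Polynomial.aeval_C, Polynomial.aeval_X]
        change f 0 * h ^ d - bind₁ f (bind₁ g (f 0)) = 0
        rw [key]; ring
    exact this.of_pow (Nat.pos_of_ne_zero hd)
  have hX : ∀ i, IsAlgebraic S (X i : MvPolynomial (Fin 3) ℂ) := by
    intro i
    have hinj := IsFractionRing.injective (MvPolynomial (Fin 3) ℂ) ConeField
    rw [← isAlgebraic_algebraMap_iff (A := ConeField) hinj]
    have e : algebraMap _ ConeField (X i : MvPolynomial (Fin 3) ℂ) =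
        algebraMap _ ConeField (bind₁ f (g i)) * (algebraMap _ ConeField h)⁻¹ := by
      have : algebraMap _ ConeField h ≠ 0 := fun hh => h0 (hinj (by rw [hh, map_zero]))
      rw [hgf, map_mul]; field_simp
    rw [e]
    refine IsAlgebraic.mul ?_ (halg.algebraMap).inv
    refine IsAlgebraic.algebraMap ?_
    exact isAlgebraic_algebraMap (⟨_, mem (g i)⟩ : S)
  have : Algebra.IsAlgebraic S (MvPolynomial (Fin 3) ℂ) := by
    refine ⟨fun p => ?_⟩
    induction p using MvPolynomial.induction_on with
    | C a => exact isAlgebraic_algebraMap (algebraMap ℂ S a)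
    | add p q hp hq => exact hp.add hq
    | mul_X p i hp => exact hp.mul (hX i)
  -- The polynomial ring is algebraic over `ℂ[f]` and has transcendence degree `3`, so the three
  -- generators form a transcendence basis.
  refine (Algebra.IsAlgebraic.isTranscendenceBasis_of_le_trdeg_of_finite (R := ℂ) f ?_).1
  rw [MvPolynomial.trdeg_of_isDomain]
  simp

/-- Two generators of the function field of the plane define a Cremona transformation. -/
theorem exists_cremonaMap {φ ψ : ConeField}
    (hφ : φ ∈ ratioField fun i => algebraMap PolyRing ConeField (X i))
    (hψ : ψ ∈ ratioField fun i => algebraMap PolyRing ConeField (X i))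
    (hgen : ∀ i, algebraMap PolyRing ConeField (X i) / algebraMap PolyRing ConeField (X 0) ∈
      ratioField ![1, φ, ψ]) :
    ∃ γ : CremonaMap, γ.form 0 ≠ 0 ∧
      algebraMap _ ConeField (γ.form 1) = φ * algebraMap _ ConeField (γ.form 0) ∧
      algebraMap _ ConeField (γ.form 2) = ψ * algebraMap _ ConeField (γ.form 0) := by
  have hinj := IsFractionRing.injective PolyRing ConeField
  have hae : ∀ p : PolyRing, aeval (fun i => algebraMap PolyRing ConeField (X i)) p =
      algebraMap PolyRing ConeField p := by
    intro p
    have := aeval_algebraMap_apply (A := PolyRing) ConeField (X : Fin 3 → PolyRing) p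
    rw [aeval_X_left_apply] at this
    exact this
  obtain ⟨n, A, B, hA, hB, hB0, hAB⟩ := mem_ratioField.1 hφ
  obtain ⟨m, A', B', hA', hB', hB0', hAB'⟩ := mem_ratioField.1 hψ
  rw [hae] at hB0 hB0'
  rw [hae, hae] at hAB hAB'
  have hne : B * B' ≠ 0 := by
    intro h
    have := congrArg (algebraMap PolyRing ConeField) h
    rw [map_mul, map_zero] at this
    exact mul_ne_zero hB0 hB0' this
  -- Over a common denominator `[1 : φ : ψ] = [B B' : A B' : B A']`; dividing by the common factor
  -- `G` makes the forms coprime.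
  obtain ⟨G, f, hGf, hcop⟩ := exists_isRelPrime_factors ![B * B', A * B', B * A'] (by simpa using hne)
  have e0 : B * B' = G * f 0 := hGf 0
  have e1 : A * B' = G * f 1 := hGf 1
  have e2 : B * A' = G * f 2 := hGf 2
  have hG0 : G ≠ 0 := by rintro rfl; exact hne (by rw [e0, zero_mul])
  have hf0 : f 0 ≠ 0 := by intro h; exact hne (by rw [e0, h, mul_zero])
  have hG0' : algebraMap PolyRing ConeField G ≠ 0 := fun h => hG0 (hinj (by rw [h, map_zero]))
  have hf0' : algebraMap PolyRing ConeField (f 0) ≠ 0 := fun h => hf0 (hinj (by rw [h, map_zero]))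
  have hFhom : ∀ i, (G * f i).IsHomogeneous (n + m) := by
    intro i
    rw [← hGf i]
    fin_cases i
    · exact hB.mul hB'
    · exact hA.mul hB'
    · exact hB.mul hA'
  obtain ⟨k, hGk, hk⟩ := (hFhom 0).of_mul_left (by rw [← e0]; exact hne)
  have hfhom : ∀ i, (f i).IsHomogeneous (n + m - k) := by
    intro i
    by_cases hi : f i = 0
    · rw [hi]; exact isHomogeneous_zero _ _ _
    · have hne' : f i * G ≠ 0 := mul_ne_zero hi hG0
      obtain ⟨l, hl, _⟩ := (mul_comm G (f i) ▸ hFhom i : (f i * G).IsHomogeneous (n + m)).of_mul_left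
        hne'
      have := (hl.mul hGk).inj_right (mul_comm G (f i) ▸ hFhom i) hne'
      convert hl using 1
      omega
  have h1 : algebraMap _ ConeField (f 1) = φ * algebraMap _ ConeField (f 0) := by
    apply mul_left_cancel₀ hG0'
    rw [← map_mul, ← e1, mul_left_comm, ← map_mul, ← e0, map_mul, map_mul, ← hAB]; ring
  have h2 : algebraMap _ ConeField (f 2) = ψ * algebraMap _ ConeField (f 0) := by
    apply mul_left_cancel₀ hG0'
    rw [← map_mul, ← e2, mul_left_comm, ← map_mul, ← e0, map_mul, map_mul, ← hAB']; ring
  set d := n + m - k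
  obtain ⟨n1, A1, B1, hA1, hB1, hB10, hAB1⟩ := mem_ratioField.1 (hgen 1)
  obtain ⟨n2, A2, B2, hA2, hB2, hB20, hAB2⟩ := mem_ratioField.1 (hgen 2)
  set w : Fin 3 → ConeField := ![1, φ, ψ]
  have hfw : (fun i => algebraMap PolyRing ConeField (f i)) =
      fun i => algebraMap PolyRing ConeField (f 0) * w i := by
    funext i
    fin_cases i
    · simp [w]
    · simp [w, h1, mul_comm]
    · simp [w, h2, mul_comm]
  have hev : ∀ {p : PolyRing} {e : ℕ}, p.IsHomogeneous e → algebraMap PolyRing ConeField (bind₁ f p) =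
      algebraMap PolyRing ConeField (f 0) ^ e * aeval w p := by
    intro p e hp
    rw [← aeval_eq_bind₁, ← hp.aeval_mul_const, ← hfw]
    exact (aeval_algebraMap_apply (A := PolyRing) ConeField f p).symm
  have hX : ∀ i : Fin 3, algebraMap PolyRing ConeField (X i) ≠ 0 := fun i h =>
    X_ne_zero (R := ℂ) i (hinj (by rw [h, map_zero]))
  -- The inverse map: `X 1 / X 0` and `X 2 / X 0`, written as rational functions of `φ` and `ψ`,
  -- with denominators cleared.
  set g : Fin 3 → PolyRing := ![B1 * B2, A1 * B2, B1 * A2]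
  have hg : ∀ i, (g i).IsHomogeneous (n1 + n2) := by
    intro i
    fin_cases i
    · exact hB1.mul hB2
    · exact hA1.mul hB2
    · exact hB1.mul hA2
  have hcross : ∀ i, bind₁ f (g i) * X 0 = bind₁ f (g 0) * X i := by
    intro i
    apply hinj
    rw [map_mul, map_mul, hev (hg i), hev (hg 0)]
    have hX0 := hX 0
    rw [div_mul_eq_mul_div, div_eq_iff hX0] at hAB1 hAB2
    fin_cases i
    · rfl
    · simp only [g, Fin.mk_one, Matrix.cons_val_one, Matrix.cons_val_zero, map_mul]
      linear_combination (-(algebraMap PolyRing ConeField (f 0)) ^ (n1 + n2) * aeval w B2) * hAB1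
    · simp only [g, Fin.reduceFinMk, Matrix.cons_val, map_mul]
      linear_combination (-(algebraMap PolyRing ConeField (f 0)) ^ (n1 + n2) * aeval w B1) * hAB2
  have hX01 : ¬ (X 0 : PolyRing) ∣ X 1 := by
    rw [X_dvd_X]; simp
  have primeX : Prime (X 0 : PolyRing) := MvPolynomial.X_prime
  -- `X 0` is prime and does not divide `X 1`, so the proportionality of `g ∘ f` and `X` has a
  -- polynomial factor `h`.
  obtain ⟨h, hh⟩ : (X 0 : PolyRing) ∣ bind₁ f (g 0) :=
    (primeX.dvd_or_dvd (⟨_, ((mul_comm _ _).trans (hcross 1)).symm⟩)).resolve_right hX01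
  have hgf : ∀ i, bind₁ f (g i) = h * X i := by
    intro i
    apply mul_right_cancel₀ primeX.ne_zero
    rw [hcross, hh]; ring
  have hg0 : bind₁ f (g 0) ≠ 0 := by
    intro hz
    have := hev (hg 0)
    rw [hz, map_zero] at this
    simp only [g, Matrix.cons_val_zero, map_mul] at this
    exact mul_ne_zero (pow_ne_zero _ hf0') (mul_ne_zero hB10 hB20) this.symm
  have hh0 : h ≠ 0 := by rintro rfl; exact hg0 (by rw [hh, mul_zero])
  -- For `d = 0` the composite `g ∘ f` would be constant, but its entries are `h * X i` with `h ≠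
  -- 0`.
  have hd : d ≠ 0 := by
    intro hd
    have := (hg 0).aeval f hfhom
    rw [aeval_eq_bind₁, hgf, hd, zero_mul] at this
    have h2 := this.totalDegree (mul_ne_zero hh0 primeX.ne_zero)
    rw [totalDegree_mul_of_isDomain hh0 primeX.ne_zero, totalDegree_X] at h2
    omega
  have hind := algebraicIndependent_of_inverse hfhom hd hf0 hh0 hgf
  have hinjf : ∀ p : PolyRing, bind₁ f p = 0 → p = 0 := fun p hp =>
    hind.eq_zero_of_aeval_eq_zero p (by rw [aeval_eq_bind₁]; exact hp)
  have hffg : ∀ i, bind₁ f (bind₁ g (f i)) = h ^ d * f i := by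
    intro i
    rw [bind₁_bind₁]
    simp_rw [hgf]
    rw [← aeval_eq_bind₁, (hfhom i).aeval_mul_const, aeval_X_left]; rfl
  -- The other composite: substituting `f` is injective by algebraic independence, so
  -- proportionality can be checked after it.
  have hcross' : ∀ i, bind₁ g (f i) * X 0 = bind₁ g (f 0) * X i := by
    intro i
    rw [← sub_eq_zero]
    apply hinjf
    rw [map_sub, map_mul, map_mul, hffg, hffg, bind₁_X_right, bind₁_X_right]; ring
  obtain ⟨h', hh'⟩ : (X 0 : PolyRing) ∣ bind₁ g (f 0) :=
    (primeX.dvd_or_dvd (⟨_, ((mul_comm _ _).trans (hcross' 1)).symm⟩)).resolve_right hX01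
  refine ⟨⟨d, f, hfhom, hcop, n1 + n2, g, hg, ⟨h, hh0, hgf⟩, h', ?_, ?_⟩, hf0, h1, h2⟩
  · rintro rfl
    have := hffg 0
    rw [hh', mul_zero, map_zero] at this
    exact mul_ne_zero (pow_ne_zero _ hh0) hf0 this.symm
  · intro i
    apply mul_right_cancel₀ primeX.ne_zero
    rw [hcross', hh']; ring

/-! ### Computing with residues in a valued field -/

section ValuedField

variable {K Γ : Type*} [Field K] [LinearOrderedCommGroupWithZero Γ]

/-- Congruence of integral elements modulo the maximal ideal of a valuation ring. -/
structure ResidueEq (v : Valuation K Γ) (a b : K) : Prop where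
  left_le : v a ≤ 1
  right_le : v b ≤ 1
  sub_lt : v (a - b) < 1

namespace ResidueEq

variable {v : Valuation K Γ} {a b a' b' : K}

lemma refl (h : v a ≤ 1) : ResidueEq v a a := ⟨h, h, by simp⟩

lemma one : ResidueEq v (1 : K) 1 := refl (by simp)

lemma of_lt_one (h : v a < 1) : ResidueEq v a 0 := ⟨h.le, by simp, by simpa using h⟩

lemma of_right_le (hb : v b ≤ 1) (h : v (a - b) < 1) : ResidueEq v a b := by
  refine ⟨?_, hb, h⟩
  have := v.map_add (a - b) b
  rw [sub_add_cancel] at this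
  exact this.trans (max_le h.le hb)

lemma add (h : ResidueEq v a b) (h' : ResidueEq v a' b') : ResidueEq v (a + a') (b + b') := by
  refine ⟨v.map_add_le h.1 h'.1, v.map_add_le h.2 h'.2, ?_⟩
  rw [add_sub_add_comm]
  exact v.map_add_lt h.3 h'.3

lemma sub (h : ResidueEq v a b) (h' : ResidueEq v a' b') : ResidueEq v (a - a') (b - b') := by
  refine ⟨v.map_sub_le h.1 h'.1, v.map_sub_le h.2 h'.2, ?_⟩
  rw [sub_sub_sub_comm]
  exact v.map_sub_lt h.3 h'.3

lemma mul (h : ResidueEq v a b) (h' : ResidueEq v a' b') : ResidueEq v (a * a') (b * b') := by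
  refine ⟨by rw [map_mul]; exact mul_le_one' h.1 h'.1, by rw [map_mul]; exact mul_le_one' h.2 h'.2,
    ?_⟩
  rw [show a * a' - b * b' = (a - b) * a' + (a' - b') * b by ring]
  refine v.map_add_lt ?_ ?_
  · rw [map_mul]; exact mul_lt_one_of_lt_of_le h.3 h'.1
  · rw [map_mul]; exact mul_lt_one_of_lt_of_le h'.3 h.2

lemma pow (h : ResidueEq v a b) (n : ℕ) : ResidueEq v (a ^ n) (b ^ n) := by
  induction n with
  | zero => simpa using refl (by simp)
  | succ n ih => rw [pow_succ, pow_succ]; exact ih.mul h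

/-- With `lt_one`, this is how values are found below: `x` and `w` are replaced by their residues,
and the resulting closed form is visibly a unit or zero. -/
lemma eq_one (h : ResidueEq v a b) (hb : v b = 1) : v a = 1 := by
  have := v.map_add_eq_of_lt_right (x := a - b) (y := b) (by rw [hb]; exact h.3)
  rwa [sub_add_cancel, hb] at this

lemma lt_one (h : ResidueEq v a b) (hb : b = 0) : v a < 1 := by
  simpa [hb] using h.3

lemma div (h : ResidueEq v a b) (h' : ResidueEq v a' b') (hb : v b' = 1) :
    ResidueEq v (a / a') (b / b') := by
  have ha := h'.eq_one hb
  have e1 : a' ≠ 0 := by rintro rfl; simp at ha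
  have e2 : b' ≠ 0 := by rintro rfl; simp at hb
  have := (h.mul (refl hb.le)).sub (h'.mul (refl h.2))
  refine ⟨by simpa [ha] using h.1, by simpa [hb] using h.2, ?_⟩
  rw [div_sub_div _ _ e1 e2, map_div₀, map_mul, ha, hb, mul_one, div_one]
  have h3 := (h.mul (refl hb.le)).sub (h'.mul (refl h.2))
  rw [show b * b' - b' * b = 0 by ring] at h3
  exact h3.lt_one rfl

end ResidueEq

end ValuedField

/-! ### The ruling and its values along the fibres and sections -/

section Ruling

variable {K Γ : Type*} [Field K] [Algebra ℂ K] [LinearOrderedCommGroupWithZero Γ]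

/-- The residue of `f` is not a complex number. -/
def ResidueNonconstant (v : Valuation K Γ) (f : K) : Prop := ∀ c : ℂ, v (f - algebraMap ℂ K c) = 1

/-- The nonzero complex numbers are units of the valuation ring. -/
def TrivialOnConstants (v : Valuation K Γ) : Prop := ∀ c : ℂ, c ≠ 0 → v (algebraMap ℂ K c) = 1

variable {v : Valuation K Γ}

lemma TrivialOnConstants.residueEq (hv : TrivialOnConstants v) (c : ℂ) :
    ResidueEq v (algebraMap ℂ K c) (algebraMap ℂ K c) := by
  apply ResidueEq.refl
  by_cases hc : c = 0
  · simp [hc]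
  · exact (hv c hc).le

lemma TrivialOnConstants.sub (hv : TrivialOnConstants v) {a b : ℂ} (h : a ≠ b) :
    v (algebraMap ℂ K a - algebraMap ℂ K b) = 1 := by
  rw [← map_sub]; exact hv _ (sub_ne_zero.2 h)

lemma ResidueNonconstant.eq_one {f : K} (hf : ResidueNonconstant v f) : v f = 1 := by
  simpa using hf 0

lemma ResidueNonconstant.linear {f : K} (hv : TrivialOnConstants v) (hf : ResidueNonconstant v f)
    {a b : ℂ} (h : a ≠ 0 ∨ b ≠ 0) : v (algebraMap ℂ K a * f + algebraMap ℂ K b) = 1 := by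
  by_cases ha : a = 0
  · simpa [ha] using hv b (h.resolve_left (not_not.2 ha))
  · have : algebraMap ℂ K a * f + algebraMap ℂ K b =
        algebraMap ℂ K a * (f - algebraMap ℂ K (-b / a)) := by
      have : algebraMap ℂ K a ≠ 0 := by simpa using ha
      rw [map_div₀, map_neg]; field_simp; ring
    rw [this, map_mul, hv a ha, hf, one_mul]

/-- A form of degree one in `x` and two in `w`, a member of the auxiliary pencil of conics. -/
noncomputable def conicMember (p q r : ℂ) (x w : K) : K :=
  x ^ 2 * w ^ 2 * (x - algebraMap ℂ K r)
    - x * w * ((algebraMap ℂ K p + algebraMap ℂ K q) * x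
      - algebraMap ℂ K q * (algebraMap ℂ K p + algebraMap ℂ K r))
    + algebraMap ℂ K p * algebraMap ℂ K r * (x - algebraMap ℂ K q)

/-- The numerator of the parameter of the ruling. -/
noncomputable def rulingNum (p q r : ℂ) (x w : K) : K :=
  x ^ 2 * w * (1 - w) * (x - algebraMap ℂ K p) * conicMember p q r x w

/-- The denominator of the parameter of the ruling. -/
noncomputable def rulingDen (p q r : ℂ) (x w : K) : K :=
  (x - algebraMap ℂ K q) * (x - algebraMap ℂ K r) * (x * w - algebraMap ℂ K p) ^ 2 *
    conicMember r q p x w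

/-- The parameter of the ruling of the plane by rational curves. -/
noncomputable def rulingParam (p q r : ℂ) (x w : K) : K := rulingNum p q r x w / rulingDen p q r x w

variable {p q r : ℂ} {x w x' w' : K}

lemma ResidueEq.conicMember (hv : TrivialOnConstants v) (hx : ResidueEq v x x')
    (hw : ResidueEq v w w') : ResidueEq v (conicMember p q r x w) (conicMember p q r x' w') :=
  ((((hx.pow 2).mul (hw.pow 2)).mul (hx.sub (hv.residueEq r))).sub
    ((hx.mul hw).mul ((((hv.residueEq p).add (hv.residueEq q)).mul hx).sub
      ((hv.residueEq q).mul ((hv.residueEq p).add (hv.residueEq r)))))).add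
    (((hv.residueEq p).mul (hv.residueEq r)).mul (hx.sub (hv.residueEq q)))

lemma ResidueEq.rulingNum (hv : TrivialOnConstants v) (hx : ResidueEq v x x')
    (hw : ResidueEq v w w') : ResidueEq v (rulingNum p q r x w) (rulingNum p q r x' w') :=
  ((((hx.pow 2).mul hw).mul (ResidueEq.one.sub hw)).mul (hx.sub (hv.residueEq p))).mul
    (hx.conicMember hv hw)

lemma ResidueEq.rulingDen (hv : TrivialOnConstants v) (hx : ResidueEq v x x')
    (hw : ResidueEq v w w') : ResidueEq v (rulingDen p q r x w) (rulingDen p q r x' w') :=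
  (((hx.sub (hv.residueEq q)).mul (hx.sub (hv.residueEq r))).mul
    (((hx.mul hw).sub (hv.residueEq p)).pow 2)).mul (hx.conicMember hv hw)

/-- The parameters of the ruling are pairwise distinct and different from `0` and `1`. -/
structure RulingConstants (p q r : ℂ) : Prop where
  p0 : p ≠ 0
  q0 : q ≠ 0
  r0 : r ≠ 0
  p1 : p ≠ 1
  q1 : q ≠ 1
  r1 : r ≠ 1
  pq : p ≠ q
  pr : p ≠ r
  qr : q ≠ r

lemma rulingParam_lt_one (hnum : v (rulingNum p q r x w) < 1) (hden : v (rulingDen p q r x w) = 1) :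
    v (rulingParam p q r x w) < 1 := by
  rw [rulingParam, map_div₀, hden, div_one]; exact hnum

/-- At `x = p` the denominator is a nonzero constant times `(w - 1) ^ 3`, whereas the numerator has
the factor `x - p`; so `U` vanishes along this fibre. -/
lemma rulingDen_fibre_p (hv : TrivialOnConstants v) (h : RulingConstants p q r)
    (hx : v (x - algebraMap ℂ K p) < 1) (hw : ResidueNonconstant v w) :
    v (rulingDen p q r x w) = 1 := by
  have hx' := ResidueEq.of_right_le (hv p h.p0).le hx
  refine (hx'.rulingDen hv (ResidueEq.refl hw.eq_one.le)).eq_one ?_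
  have e : rulingDen p q r (algebraMap ℂ K p) w =
      -((algebraMap ℂ K p - algebraMap ℂ K q) ^ 2 * (algebraMap ℂ K p - algebraMap ℂ K r) *
        algebraMap ℂ K p ^ 3 * algebraMap ℂ K r * (w - algebraMap ℂ K 1) ^ 3) := by
    rw [rulingDen, conicMember, map_one]; ring
  rw [e, Valuation.map_neg]
  simp only [map_mul, map_pow, hv.sub h.pq, hv.sub h.pr, hv p h.p0, hv r h.r0, hw 1, one_pow, mul_one]

lemma rulingParam_fibre_p (hv : TrivialOnConstants v) (h : RulingConstants p q r)
    (hx : v (x - algebraMap ℂ K p) < 1) (hw : ResidueNonconstant v w) :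
    v (rulingParam p q r x w) < 1 := by
  have hx' := ResidueEq.of_right_le (hv p h.p0).le hx
  refine rulingParam_lt_one ?_ (rulingDen_fibre_p hv h hx hw)
  refine (hx'.rulingNum hv (ResidueEq.refl hw.eq_one.le)).lt_one ?_
  rw [rulingNum]; ring

/-- Here the factor `x - q` sits in the denominator and the numerator becomes a nonzero constant
times `w ^ 2 (w - 1) ^ 2`, so `U` has a pole. -/
lemma rulingNum_fibre_q (hv : TrivialOnConstants v) (h : RulingConstants p q r)
    (hx : v (x - algebraMap ℂ K q) < 1) (hw : ResidueNonconstant v w) :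
    v (rulingNum p q r x w) = 1 := by
  have hx' := ResidueEq.of_right_le (hv q h.q0).le hx
  refine (hx'.rulingNum hv (ResidueEq.refl hw.eq_one.le)).eq_one ?_
  have e : rulingNum p q r (algebraMap ℂ K q) w =
      (algebraMap ℂ K p - algebraMap ℂ K q) * (algebraMap ℂ K q - algebraMap ℂ K r) *
        algebraMap ℂ K q ^ 4 * w ^ 2 * (w - algebraMap ℂ K 1) ^ 2 := by
    rw [rulingNum, conicMember, map_one]; ring
  rw [e]
  simp only [map_mul, map_pow, hv.sub h.pq, hv.sub h.qr, hv q h.q0, hw.eq_one, hw 1, one_pow, mul_one]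

lemma rulingParam_inv_lt_one (hnum : v (rulingNum p q r x w) = 1)
    (hden : v (rulingDen p q r x w) < 1) : v (rulingParam p q r x w)⁻¹ < 1 := by
  rw [rulingParam, inv_div, map_div₀, hnum, div_one]; exact hden

lemma rulingParam_fibre_q (hv : TrivialOnConstants v) (h : RulingConstants p q r)
    (hx : v (x - algebraMap ℂ K q) < 1) (hw : ResidueNonconstant v w) :
    v (rulingParam p q r x w)⁻¹ < 1 := by
  have hx' := ResidueEq.of_right_le (hv q h.q0).le hx
  refine rulingParam_inv_lt_one (rulingNum_fibre_q hv h hx hw) ?_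
  refine (hx'.rulingDen hv (ResidueEq.refl hw.eq_one.le)).lt_one ?_
  rw [rulingDen]; ring

lemma rulingParam_fibre_r (hv : TrivialOnConstants v) (h : RulingConstants p q r)
    (hx : v (x - algebraMap ℂ K r) < 1) (hw : ResidueNonconstant v w) :
    v (rulingParam p q r x w)⁻¹ < 1 := by
  have hx' := ResidueEq.of_right_le (hv r h.r0).le hx
  refine rulingParam_inv_lt_one ?_ ?_
  · refine (hx'.rulingNum hv (ResidueEq.refl hw.eq_one.le)).eq_one ?_
    have e : rulingNum p q r (algebraMap ℂ K r) w =
        (algebraMap ℂ K p - algebraMap ℂ K r) * (algebraMap ℂ K q - algebraMap ℂ K r) *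
          algebraMap ℂ K p * algebraMap ℂ K r ^ 3 * w * (w - algebraMap ℂ K 1) ^ 2 := by
      rw [rulingNum, conicMember, map_one]; ring
    rw [e]
    simp only [map_mul, map_pow, hv.sub h.pr, hv.sub h.qr, hv p h.p0, hv r h.r0,
      hw.eq_one, hw 1, one_pow, mul_one]
  · refine (hx'.rulingDen hv (ResidueEq.refl hw.eq_one.le)).lt_one ?_
    rw [rulingDen]; ring

lemma rulingParam_fibre_zero (hv : TrivialOnConstants v) (h : RulingConstants p q r)
    (hx : v x < 1) (hw : ResidueNonconstant v w) : v (rulingParam p q r x w) < 1 := by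
  have hx' := ResidueEq.of_lt_one hx
  have hw' := ResidueEq.refl hw.eq_one.le
  refine rulingParam_lt_one ((hx'.rulingNum hv hw').lt_one ?_) ((hx'.rulingDen hv hw').eq_one ?_)
  · rw [rulingNum]; ring
  · have e : rulingDen p q r (0 : K) w =
        -(algebraMap ℂ K q ^ 2 * algebraMap ℂ K r ^ 2 * algebraMap ℂ K p ^ 3) := by
      rw [rulingDen, conicMember]; ring
    rw [e, Valuation.map_neg]
    simp only [map_mul, map_pow, hv q h.q0, hv r h.r0, hv p h.p0, one_pow, mul_one]

lemma rulingParam_fibre_infty (hv : TrivialOnConstants v)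
    (hx : v x⁻¹ < 1) (hw : ResidueNonconstant v w) : v (rulingParam p q r x w) < 1 := by
  by_cases hx0 : x = 0
  -- Because `0⁻¹ = 0`, the value `x = 0` also satisfies `hx`; the numerator is then `0`.
  · simp [hx0, rulingParam, rulingNum]
  set y := x⁻¹ with hy
  have hy0 : y ≠ 0 := inv_ne_zero hx0
  have hxy : x = y⁻¹ := by rw [hy, inv_inv]
  have hy' := ResidueEq.of_lt_one hx
  have hw' := ResidueEq.refl hw.eq_one.le
  have hc : ∀ p q r : ℂ, ResidueEq v (conicMember p q r x w * y ^ 3) (w ^ 2) := by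
    intro p q r
    have e : conicMember p q r x w * y ^ 3 = w ^ 2 * (1 - algebraMap ℂ K r * y)
        - w * y * ((algebraMap ℂ K p + algebraMap ℂ K q)
          - algebraMap ℂ K q * (algebraMap ℂ K p + algebraMap ℂ K r) * y)
        + algebraMap ℂ K p * algebraMap ℂ K r * y ^ 2 * (1 - algebraMap ℂ K q * y) := by
      rw [conicMember, hxy]; field_simp
    have := (((hw'.pow 2).mul (ResidueEq.one.sub ((hv.residueEq r).mul hy'))).sub
      ((hw'.mul hy').mul (((hv.residueEq p).add (hv.residueEq q)).sub
        (((hv.residueEq q).mul ((hv.residueEq p).add (hv.residueEq r))).mul hy')))).add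
      ((((hv.residueEq p).mul (hv.residueEq r)).mul (hy'.pow 2)).mul
        (ResidueEq.one.sub ((hv.residueEq q).mul hy')))
    rw [← e] at this
    convert this using 1
    ring
  have hl : ∀ c : ℂ, v ((x - algebraMap ℂ K c) * y) = 1 := by
    intro c
    have e : (x - algebraMap ℂ K c) * y = 1 - algebraMap ℂ K c * y := by
      rw [hxy]; field_simp
    rw [e]
    refine (ResidueEq.one.sub ((hv.residueEq c).mul hy')).eq_one ?_
    simp
  -- The numerator has degree `6` in `x` and the denominator degree `7`, which leaves one factor `y
  -- = x⁻¹` in `U`.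
  have hn : v (rulingNum p q r x w * y ^ 6) = 1 := by
    have e : rulingNum p q r x w * y ^ 6 = -(w * (w - algebraMap ℂ K 1) *
        ((x - algebraMap ℂ K p) * y) * (conicMember p q r x w * y ^ 3)) := by
      rw [rulingNum, map_one]; nth_rw 1 [hxy]; field_simp; ring
    rw [e, Valuation.map_neg]
    simp only [map_mul v w, map_mul v (w * _), map_mul v (w * _ * _), hw.eq_one, hw 1, hl,
      (hc p q r).eq_one (by simp [hw.eq_one]), mul_one]
  have hd : v (rulingDen p q r x w * y ^ 7) = 1 := by
    have e : rulingDen p q r x w * y ^ 7 = ((x - algebraMap ℂ K q) * y) *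
        ((x - algebraMap ℂ K r) * y) * (w - algebraMap ℂ K p * y) ^ 2 *
        (conicMember r q p x w * y ^ 3) := by
      rw [rulingDen]
      have : x * w - algebraMap ℂ K p = x * (w - algebraMap ℂ K p * y) := by rw [hxy]; field_simp
      have h1 : x * y = 1 := mul_inv_cancel₀ hx0
      rw [this]
      linear_combination ((x - algebraMap ℂ K q) * (x - algebraMap ℂ K r) *
        (w - algebraMap ℂ K p * y) ^ 2 * conicMember r q p x w * y ^ 5) * (x * y + 1) * h1
    have h2 : v (w - algebraMap ℂ K p * y) = 1 := by
      refine (hw'.sub ((hv.residueEq p).mul hy')).eq_one ?_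
      simpa using hw.eq_one
    rw [e, map_mul, map_mul, map_mul, map_pow, hl, hl, h2, (hc r q p).eq_one (by simp [hw.eq_one])]
    simp
  have e : rulingParam p q r x w =
      (rulingNum p q r x w * y ^ 6) / (rulingDen p q r x w * y ^ 7) * y := by
    rw [rulingParam]; field_simp
  rw [e, map_mul, map_div₀, hn, hd, div_one, one_mul]
  exact hx

lemma rulingParam_section_zero (hv : TrivialOnConstants v) (h : RulingConstants p q r)
    (hw : v w < 1) (hx : ResidueNonconstant v x) : v (rulingParam p q r x w) < 1 := by
  have hw' := ResidueEq.of_lt_one hw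
  have hx' := ResidueEq.refl hx.eq_one.le
  refine rulingParam_lt_one ((hx'.rulingNum hv hw').lt_one ?_) ((hx'.rulingDen hv hw').eq_one ?_)
  · rw [rulingNum]; ring
  · have e : rulingDen p q r x (0 : K) = (x - algebraMap ℂ K q) ^ 2 * (x - algebraMap ℂ K r) *
        algebraMap ℂ K r * algebraMap ℂ K p ^ 3 := by
      rw [rulingDen, conicMember]; ring
    rw [e]
    simp only [map_mul, map_pow, hx q, hx r, hv r h.r0, hv p h.p0, one_pow, mul_one]

lemma rulingDen_one : rulingDen p q r x (1 : K) = (x - algebraMap ℂ K q) ^ 2 *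
    (x - algebraMap ℂ K r) ^ 2 * (x - algebraMap ℂ K p) ^ 3 := by
  rw [rulingDen, conicMember]; ring

lemma rulingParam_section_one (hv : TrivialOnConstants v)
    (hw : v (w - 1) < 1) (hx : ResidueNonconstant v x) : v (rulingParam p q r x w) < 1 := by
  have hw' := ResidueEq.of_right_le (by simp) hw
  have hx' := ResidueEq.refl hx.eq_one.le
  refine rulingParam_lt_one ((hx'.rulingNum hv hw').lt_one ?_) ((hx'.rulingDen hv hw').eq_one ?_)
  · rw [rulingNum]; ring
  · rw [rulingDen_one]
    simp only [map_mul, map_pow, hx q, hx r, hx p, one_pow, mul_one]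

/-- For the line `ez = 0`, which maps to the point `x = w = 1`: the factor `1 - w` kills the
numerator, and `p, q, r ≠ 1` keep the denominator a unit. -/
lemma rulingParam_point_one (hv : TrivialOnConstants v) (h : RulingConstants p q r)
    (hw : v (w - 1) < 1) (hx : v (x - 1) < 1) : v (rulingParam p q r x w) < 1 := by
  have hw' := ResidueEq.of_right_le (by simp) hw
  have hx' := ResidueEq.of_right_le (by simp) hx
  refine rulingParam_lt_one ((hx'.rulingNum hv hw').lt_one ?_) ((hx'.rulingDen hv hw').eq_one ?_)
  · rw [rulingNum]; ring
  · rw [rulingDen_one, ← map_one (algebraMap ℂ K)]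
    simp only [map_mul, map_pow, hv.sub h.p1.symm, hv.sub h.q1.symm, hv.sub h.r1.symm, one_pow,
      mul_one]

/-- A coordinate on the fibres of the ruling, which vanishes on the section at infinity. -/
noncomputable def fibreParam (p q r : ℂ) (x w : K) : K :=
  conicMember p q r x w / conicMember r q p x w *
      ((algebraMap ℂ K q - algebraMap ℂ K p) * rulingParam p q r x w - 1)
    - ((algebraMap ℂ K q - algebraMap ℂ K r) * rulingParam p q r x w - 1)

/-- The ruling and the coordinate on its fibres along the section at infinity. -/
lemma section_infty (hv : TrivialOnConstants v)
    (hw : v w⁻¹ < 1) (hw0 : w ≠ 0) (hx : ResidueNonconstant v x) :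
    v (rulingParam p q r x w) = 1 ∧ v (1 + rulingParam p q r x w) = 1 ∧
      v (fibreParam p q r x w) < 1 := by
  set y := w⁻¹ with hy
  have hy0 : y ≠ 0 := inv_ne_zero hw0
  have hwy : w = y⁻¹ := by rw [hy, inv_inv]
  have hy' := ResidueEq.of_lt_one hw
  have hx' := ResidueEq.refl hx.eq_one.le
  have hc : ∀ p q r : ℂ, ResidueEq v (conicMember p q r x w * y ^ 2)
      (x ^ 2 * (x - algebraMap ℂ K r)) := by
    intro p q r
    have e : conicMember p q r x w * y ^ 2 = x ^ 2 * (x - algebraMap ℂ K r)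
        - x * y * ((algebraMap ℂ K p + algebraMap ℂ K q) * x
          - algebraMap ℂ K q * (algebraMap ℂ K p + algebraMap ℂ K r))
        + algebraMap ℂ K p * algebraMap ℂ K r * y ^ 2 * (x - algebraMap ℂ K q) := by
      rw [conicMember, hwy]; field_simp
    have := (((hx'.pow 2).mul (hx'.sub (hv.residueEq r))).sub
      ((hx'.mul hy').mul ((((hv.residueEq p).add (hv.residueEq q)).mul hx').sub
        ((hv.residueEq q).mul ((hv.residueEq p).add (hv.residueEq r)))))).add
      ((((hv.residueEq p).mul (hv.residueEq r)).mul (hy'.pow 2)).mul (hx'.sub (hv.residueEq q)))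
    rw [← e] at this
    convert this using 1
    ring
  have hcu : ∀ p q r : ℂ, v (conicMember p q r x w * y ^ 2) = 1 := fun p q r =>
    (hc p q r).eq_one (by simp only [map_mul, map_pow, hx.eq_one, hx r, one_pow, mul_one])
  -- Numerator and denominator both have degree `4` in `w`; the quotient of the leading coefficients
  -- gives `U` the residue `-1 / (x - q)`.
  have hn : ResidueEq v (rulingNum p q r x w * y ^ 4)
      (-(x ^ 4 * (x - algebraMap ℂ K p) * (x - algebraMap ℂ K r))) := by
    have e : rulingNum p q r x w * y ^ 4 =
        x ^ 2 * (y - 1) * (x - algebraMap ℂ K p) * (conicMember p q r x w * y ^ 2) := by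
      rw [rulingNum]
      have h1 : w * y = 1 := mul_inv_cancel₀ hw0
      linear_combination (x ^ 2 * (x - algebraMap ℂ K p) * conicMember p q r x w * y ^ 2) *
        (y - 1 - w * y) * h1
    rw [e]
    convert! (((hx'.pow 2).mul (hy'.sub ResidueEq.one)).mul (hx'.sub (hv.residueEq p))).mul (hc p q r)
      using 1
    ring
  have hd : ResidueEq v (rulingDen p q r x w * y ^ 4)
      (x ^ 4 * (x - algebraMap ℂ K p) * (x - algebraMap ℂ K q) * (x - algebraMap ℂ K r)) := by
    have e : rulingDen p q r x w * y ^ 4 = (x - algebraMap ℂ K q) * (x - algebraMap ℂ K r) *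
        (x - algebraMap ℂ K p * y) ^ 2 * (conicMember r q p x w * y ^ 2) := by
      rw [rulingDen]
      have h2 : x * w - algebraMap ℂ K p = w * (x - algebraMap ℂ K p * y) := by
        rw [hwy]; field_simp
      have h1 : w * y = 1 := mul_inv_cancel₀ hw0
      rw [h2]
      linear_combination ((x - algebraMap ℂ K q) * (x - algebraMap ℂ K r) *
        (x - algebraMap ℂ K p * y) ^ 2 * conicMember r q p x w * y ^ 2) * (w * y + 1) * h1
    rw [e]
    convert! (((hx'.sub (hv.residueEq q)).mul (hx'.sub (hv.residueEq r))).mul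
      ((hx'.sub ((hv.residueEq p).mul hy')).pow 2)).mul (hc r q p) using 1
    ring
  have hnu : v (rulingNum p q r x w * y ^ 4) = 1 := hn.eq_one (by
    rw [Valuation.map_neg]
    simp only [map_mul, map_pow, hx.eq_one, hx r, hx p, one_pow, mul_one])
  have hdu : v (rulingDen p q r x w * y ^ 4) = 1 := hd.eq_one (by
    simp only [map_mul, map_pow, hx.eq_one, hx r, hx p, hx q, one_pow, mul_one])
  have hd0 : rulingDen p q r x w * y ^ 4 ≠ 0 := by intro h; simp [h] at hdu
  have hc0 : conicMember r q p x w * y ^ 2 ≠ 0 := by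
    intro h; have := hcu r q p; simp [h] at this
  have eU : rulingParam p q r x w = (rulingNum p q r x w * y ^ 4) / (rulingDen p q r x w * y ^ 4) := by
    rw [rulingParam]; field_simp
  refine ⟨?_, ?_, ?_⟩
  · rw [eU, map_div₀, hnu, hdu, div_one]
  · have : 1 + rulingParam p q r x w =
        (rulingDen p q r x w * y ^ 4 + rulingNum p q r x w * y ^ 4) / (rulingDen p q r x w * y ^ 4) := by
      rw [eU, add_div, div_self hd0]
    rw [this, map_div₀, hdu, div_one]
    refine (hd.add hn).eq_one ?_
    have e2 : x ^ 4 * (x - algebraMap ℂ K p) * (x - algebraMap ℂ K q) * (x - algebraMap ℂ K r) +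
        -(x ^ 4 * (x - algebraMap ℂ K p) * (x - algebraMap ℂ K r)) =
        x ^ 4 * (x - algebraMap ℂ K p) * (x - algebraMap ℂ K r) * (x - algebraMap ℂ K (q + 1)) := by
      rw [map_add, map_one]; ring
    rw [e2]
    simp only [map_mul, map_pow, hx.eq_one, hx r, hx p, hx (q + 1), one_pow, mul_one]
  · set N := rulingNum p q r x w * y ^ 4
    set D := rulingDen p q r x w * y ^ 4
    set G := conicMember p q r x w * y ^ 2 with hG
    set G' := conicMember r q p x w * y ^ 2 with hG'
    have eG : conicMember p q r x w / conicMember r q p x w = G / G' := by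
      rw [hG, hG']; field_simp
    have e : fibreParam p q r x w =
        (G * ((algebraMap ℂ K q - algebraMap ℂ K p) * N - D)
          - G' * ((algebraMap ℂ K q - algebraMap ℂ K r) * N - D)) / (G' * D) := by
      rw [fibreParam, eU, eG]; field_simp
    -- The residue of `G / G'` is `(x - r) / (x - p)`, and those of `(q - p) U - 1` and `(q - r) U -
    -- 1` are `-(x - p) / (x - q)` and `-(x - r) / (x - q)`. The two terms of `fibreParam` cancel,
    -- which is the reason for its coefficients.
    rw [e, map_div₀, map_mul v G', hcu r q p, hdu, one_mul, div_one]
    refine (((hc p q r).mul ((((hv.residueEq q).sub (hv.residueEq p)).mul hn).sub hd)).sub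
      ((hc r q p).mul ((((hv.residueEq q).sub (hv.residueEq r)).mul hn).sub hd))).lt_one ?_
    ring

end Ruling

/-! ### Coordinates adapted to the fibres and sections -/

/-- The cross ratio of `0`, `1`, `ξ` and `η`. -/
noncomputable def crossCoord {K : Type*} [Field K] (ξ η : K) : K := η * (ξ - 1) / ((η - 1) * ξ)

/-- Both coordinates have a pole along `ez = 0`. Together with `pencilCoord_infty` this collapses
that line to the point `x = w = 1`. -/
lemma crossCoord_infty {K Γ : Type*} [Field K] [LinearOrderedCommGroupWithZero Γ]
    {v : Valuation K Γ} {ξ η : K} (hξ : v ξ⁻¹ < 1) (hη : v η⁻¹ < 1) (hξ0 : ξ ≠ 0) (hη0 : η ≠ 0) :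
    v (crossCoord ξ η - 1) < 1 := by
  have h := ResidueEq.of_lt_one hξ
  have h' := ResidueEq.of_lt_one hη
  have := ((ResidueEq.one.sub h).div (ResidueEq.one.sub h') (by simp)).sub_lt
  convert this using 2
  have e : crossCoord ξ η = (1 - ξ⁻¹) / (1 - η⁻¹) := by
    rw [crossCoord, ← mul_div_mul_right _ _ (mul_ne_zero (inv_ne_zero hξ0) (inv_ne_zero hη0))]
    congr 1 <;> field_simp
  rw [e]; simp

section Coordinates

variable {K Γ : Type*} [Field K] [Algebra ℂ K] [LinearOrderedCommGroupWithZero Γ]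

/-- The coordinate on the pencil of lines, normalised at the lines with parameters `a` and `b`. -/
noncomputable def pencilCoord (a b : ℂ) (ξ : K) : K := (ξ - algebraMap ℂ K b) / (ξ - algebraMap ℂ K a)

variable {v : Valuation K Γ} {ξ η : K} {a b c : ℂ}

/-- Over `ξ = c` the map `η ↦ w` is a Möbius transformation of determinant `-c (c - 1)`. It
degenerates only for `c = 0, 1`, the fibres through the points where `η = ξ` meets `η = 0` and `η =
1`. -/
lemma crossCoord_nonconstant (hv : TrivialOnConstants v) (h0 : c ≠ 0) (h1 : c ≠ 1)
    (hξ : v (ξ - algebraMap ℂ K c) < 1) (hη : ResidueNonconstant v η) :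
    ResidueNonconstant v (crossCoord ξ η) := by
  intro d
  have hξ' := ResidueEq.of_right_le (hv c h0).le hξ
  have hη' := ResidueEq.refl hη.eq_one.le
  have hη1 : v (η - 1) = 1 := by simpa using hη 1
  have hξ1 := hξ'.eq_one (hv c h0)
  have e1 : η - 1 ≠ 0 := by intro h; simp [h] at hη1
  have e2 : ξ ≠ 0 := by intro h; simp [h] at hξ1
  have e : crossCoord ξ η - algebraMap ℂ K d =
      (η * (ξ - 1) - algebraMap ℂ K d * ((η - 1) * ξ)) / ((η - 1) * ξ) := by
    rw [crossCoord]; field_simp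
  rw [e, map_div₀, map_mul v (η - 1), hη1, hξ1, one_mul, div_one]
  refine ((hη'.mul (hξ'.sub ResidueEq.one)).sub ((hv.residueEq d).mul
    ((hη'.sub ResidueEq.one).mul hξ'))).eq_one ?_
  have e3 : η * (algebraMap ℂ K c - 1) - algebraMap ℂ K d * ((η - 1) * algebraMap ℂ K c) =
      algebraMap ℂ K (c - 1 - d * c) * η + algebraMap ℂ K (d * c) := by
    simp only [map_sub, map_mul, map_one]; ring
  rw [e3]
  refine hη.linear hv ?_
  by_cases hd : d = 0
  · left; simpa [hd, sub_eq_zero] using h1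
  · right; exact mul_ne_zero hd h0

lemma pencilCoord_residue (hv : TrivialOnConstants v) (hca : c ≠ a)
    (hξ : v (ξ - algebraMap ℂ K c) < 1) :
    v (pencilCoord a b ξ - algebraMap ℂ K ((c - b) / (c - a))) < 1 := by
  have hξ' := ResidueEq.of_right_le (hv.residueEq c).left_le hξ
  have := ((hξ'.sub (hv.residueEq b)).div (hξ'.sub (hv.residueEq a)) (hv.sub hca)).sub_lt
  rwa [← map_sub, ← map_sub, ← map_div₀] at this

lemma pencilCoord_lt_one (hv : TrivialOnConstants v) (hab : a ≠ b)
    (hξ : v (ξ - algebraMap ℂ K b) < 1) : v (pencilCoord a b ξ) < 1 := by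
  simpa using pencilCoord_residue (b := b) hv hab.symm hξ

lemma pencilCoord_inv_lt_one (hv : TrivialOnConstants v) (hab : a ≠ b)
    (hξ : v (ξ - algebraMap ℂ K a) < 1) : v (pencilCoord a b ξ)⁻¹ < 1 := by
  have : (pencilCoord a b ξ)⁻¹ = pencilCoord b a ξ := by rw [pencilCoord, pencilCoord, inv_div]
  rw [this]
  exact pencilCoord_lt_one hv hab.symm hξ

lemma pencilCoord_nonconstant (hv : TrivialOnConstants v) (hab : a ≠ b)
    (hξ : ResidueNonconstant v ξ) : ResidueNonconstant v (pencilCoord a b ξ) := by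
  intro d
  have h1 := hξ a
  have h0 : ξ - algebraMap ℂ K a ≠ 0 := by intro h; simp [h] at h1
  have e : pencilCoord a b ξ - algebraMap ℂ K d =
      (algebraMap ℂ K (1 - d) * ξ + algebraMap ℂ K (d * a - b)) / (ξ - algebraMap ℂ K a) := by
    rw [pencilCoord]; simp only [map_sub, map_mul, map_one]; field_simp; ring
  rw [e, map_div₀, h1, div_one]
  refine hξ.linear hv ?_
  by_cases hd : d = 1
  · right; rw [hd, one_mul]; exact sub_ne_zero.2 hab
  · left; exact sub_ne_zero.2 (Ne.symm hd)

lemma pencilCoord_infty (hv : TrivialOnConstants v) (hξ : v ξ⁻¹ < 1) (hξ0 : ξ ≠ 0) :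
    v (pencilCoord a b ξ - 1) < 1 := by
  have h := ResidueEq.of_lt_one hξ
  have := ((ResidueEq.one.sub ((hv.residueEq b).mul h)).div
    (ResidueEq.one.sub ((hv.residueEq a).mul h)) (by simp)).sub_lt
  convert this using 2
  have e : pencilCoord a b ξ = (1 - algebraMap ℂ K b * ξ⁻¹) / (1 - algebraMap ℂ K a * ξ⁻¹) := by
    rw [pencilCoord, ← mul_div_mul_right _ _ (inv_ne_zero hξ0), sub_mul, sub_mul,
      mul_inv_cancel₀ hξ0]
  rw [e]; simp

/-- This lemma and the next two send the sections `η = 0`, `η = 1`, `η = ξ` to `w = 0, ∞, 1`. -/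
lemma crossCoord_zero (hξ : ResidueNonconstant v ξ) (hη : v η < 1) : v (crossCoord ξ η) < 1 := by
  have h := ResidueEq.of_lt_one hη
  have h' := ResidueEq.refl hξ.eq_one.le
  refine ((h.mul (h'.sub ResidueEq.one)).div ((h.sub ResidueEq.one).mul h') ?_).lt_one ?_
  · simp [hξ.eq_one]
  · simp

lemma crossCoord_inv (hξ : ResidueNonconstant v ξ) (hη : v (η - 1) < 1) :
    v (crossCoord ξ η)⁻¹ < 1 := by
  have h := ResidueEq.of_right_le (by simp) hη
  have h' := ResidueEq.refl hξ.eq_one.le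
  rw [crossCoord, inv_div]
  refine (((h.sub ResidueEq.one).mul h').div (h.mul (h'.sub ResidueEq.one)) ?_).lt_one ?_
  · simpa using hξ 1
  · simp

lemma crossCoord_one (hξ : ResidueNonconstant v ξ) (hη : v (ξ - η) < 1) :
    v (crossCoord ξ η - 1) < 1 := by
  have h' := ResidueEq.refl hξ.eq_one.le
  have h : ResidueEq v η ξ := ResidueEq.of_right_le hξ.eq_one.le (by rwa [← Valuation.map_sub_swap])
  have h1 : v (ξ - 1) = 1 := by simpa using hξ 1
  have e0 : ξ ≠ 0 := by rintro rfl; simpa using hξ.eq_one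
  have e1 : ξ - 1 ≠ 0 := by intro hz; simp [hz] at h1
  have := ((h.mul (h'.sub ResidueEq.one)).div ((h.sub ResidueEq.one).mul h')
    (by rw [map_mul, h1, hξ.eq_one, one_mul])).sub_lt
  rwa [mul_comm ξ, div_self (mul_ne_zero e1 e0)] at this

end Coordinates

/-! ### Recovering the coordinates from the ruling -/

section Recovery

variable {K Γ : Type*} [Field K] [Algebra ℂ K] [LinearOrderedCommGroupWithZero Γ]

/-- The ruling and the coordinate on its fibres generate the function field. -/
lemma mem_of_ruling_mem (S : IntermediateField ℂ K) {p q r : ℂ} (h : RulingConstants p q r)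
    {x w t U : K} (ht : t = conicMember p q r x w / conicMember r q p x w)
    (hUdef : U = rulingParam p q r x w)
    (hN : rulingNum p q r x w ≠ 0) (hD : rulingDen p q r x w ≠ 0)
    (h1 : (algebraMap ℂ K q - algebraMap ℂ K p) * U - 1 ≠ 0)
    (hE : U * (algebraMap ℂ K r - algebraMap ℂ K q - t * (algebraMap ℂ K p - algebraMap ℂ K q))
      + 1 - t ≠ 0)
    (hyq : x * w - algebraMap ℂ K q ≠ 0) (hyr : x * w - algebraMap ℂ K r ≠ 0)
    (hU : U ∈ S) (hW : fibreParam p q r x w ∈ S) : x ∈ S ∧ w ∈ S := by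
  set P := algebraMap ℂ K p with hP
  set Q := algebraMap ℂ K q with hQ
  set R := algebraMap ℂ K r with hR
  have mP : P ∈ S := S.algebraMap_mem p
  have mQ : Q ∈ S := S.algebraMap_mem q
  have mR : R ∈ S := S.algebraMap_mem r
  have m1 : (1 : K) ∈ S := S.one_mem
  have hRP : R - P ≠ 0 := by
    rw [hR, hP, ← map_sub]; simpa [sub_eq_zero] using h.pr.symm
  simp only [rulingNum, rulingDen, mul_ne_zero_iff, ← hP, ← hQ, ← hR, ne_eq,
    pow_eq_zero_iff, OfNat.ofNat_ne_zero, not_false_eq_true] at hN hD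
  obtain ⟨⟨⟨⟨x0, w0⟩, w1⟩, xp⟩, G0⟩ := hN
  obtain ⟨⟨⟨xq, xr⟩, yp⟩, G0'⟩ := hD
  have t0 : t ≠ 0 := by rw [ht]; exact div_ne_zero G0 G0'
  -- `fibreParam` is affine in `t` with coefficients in `ℂ(U)`.
  have tmem : t ∈ S := by
    have : t = (fibreParam p q r x w + (Q - R) * U - 1) / ((Q - P) * U - 1) := by
      rw [fibreParam, ← ht, ← hUdef, eq_div_iff h1]; ring
    rw [this]
    exact S.div_mem (S.sub_mem (S.add_mem hW (S.mul_mem (S.sub_mem mQ mR) hU)) m1)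
      (S.sub_mem (S.mul_mem (S.sub_mem mQ mP) hU) m1)
  set y := x * w with hy
  have y0 : y ≠ 0 := mul_ne_zero x0 w0
  have hG : t * conicMember r q p x w = conicMember p q r x w := by rw [ht]; field_simp
  -- In terms of `y = x w`, each `conicMember` has degree one in `x` and two in `y`; so `t` and `y`
  -- determine `x`.
  have hG1 : t * (x * (y ^ 2 - (R + Q) * y + P * R) - (P * y ^ 2 - Q * (P + R) * y + P * Q * R)) =
      x * (y ^ 2 - (P + Q) * y + P * R) - (R * y ^ 2 - Q * (P + R) * y + P * Q * R) := by
    rw [conicMember, conicMember, ← hP, ← hQ, ← hR] at hG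
    rw [hy]; linear_combination hG
  set D := (1 - t) * y ^ 2 - ((P + Q) - t * (R + Q)) * y + P * R * (1 - t) with hDdef
  have hxD : x * D = (R - t * P) * y ^ 2 - Q * (P + R) * (1 - t) * y + P * Q * R * (1 - t) := by
    rw [hDdef]; linear_combination -hG1
  have hD0 : D ≠ 0 := by
    have : D * conicMember r q p x w = (R - P) * y * (y - P) * (y - Q) * (y - R) := by
      have e : conicMember r q p x w = x * (y ^ 2 - (R + Q) * y + P * R)
          - (P * y ^ 2 - Q * (P + R) * y + P * Q * R) := by
        rw [conicMember, ← hP, ← hQ, ← hR, hy]; ring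
      rw [e, hDdef]
      linear_combination -(y ^ 2 - (R + Q) * y + P * R) * hG1
    refine left_ne_zero_of_mul (b := conicMember r q p x w) ?_
    rw [this]
    exact mul_ne_zero (mul_ne_zero (mul_ne_zero (mul_ne_zero hRP y0) yp) hyq) hyr
  set s := R - Q - t * (P - Q) with hs
  -- After elimination of `x`, both sides of the equation defining `U` contain the factor `y (y - P)
  -- ^ 2 (y - Q) (y - R)`. Once it is cancelled, the equation is linear in `y`.
  have hM : U / t * (s * (t * (R - P) * y - P * (1 - t) * (Q - R))) =
      -(1 - t) * ((R - P) * y - R * (Q - P) * (1 - t)) := by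
    have h2 : U / t * ((x - Q) * (x - R) * (y - P) ^ 2) = (x - y) * y * (x - P) := by
      rw [hUdef, ht, rulingParam, rulingNum, rulingDen, ← hP, ← hQ, ← hR, ← hy]
      field_simp
      rw [hy]; ring
    have f1 : (x - y) * D = -(1 - t) * ((y - P) * (y - Q) * (y - R)) := by
      linear_combination hxD - y * hDdef
    have f2 : (x - Q) * D = y * (y - Q) * s := by linear_combination hxD - Q * hDdef - y * (y - Q) * hs
    have f3 : (x - P) * D = (y - P) * ((R - P) * y - R * (Q - P) * (1 - t)) := by
      linear_combination hxD - P * hDdef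
    have f4 : (x - R) * D = (y - R) * (t * (R - P) * y - P * (1 - t) * (Q - R)) := by
      linear_combination hxD - R * hDdef
    have hc : y * (y - P) ^ 2 * (y - Q) * (y - R) ≠ 0 :=
      mul_ne_zero (mul_ne_zero (mul_ne_zero y0 (pow_ne_zero 2 yp)) hyq) hyr
    apply mul_left_cancel₀ hc
    calc _ = U / t * ((y * (y - Q) * s) * ((y - R) * (t * (R - P) * y - P * (1 - t) * (Q - R))) *
          (y - P) ^ 2) := by ring
      _ = U / t * ((x - Q) * (x - R) * (y - P) ^ 2) * D ^ 2 := by rw [← f2, ← f4]; ring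
      _ = ((x - y) * D) * y * ((x - P) * D) := by rw [h2]; ring
      _ = _ := by rw [f1, f3]; ring
  have hyid : y * ((R - P) * (U * s + 1 - t)) =
      (1 - t) * (U / t * s * P * (Q - R) + R * (Q - P) * (1 - t)) := by
    have hU : U = U / t * t := by field_simp
    linear_combination hM + y * (R - P) * s * hU
  have ymem : y ∈ S := by
    have hne := mul_ne_zero hRP hE
    rw [eq_div_of_mul_eq hne hyid]
    have ms : s ∈ S :=
      S.sub_mem (S.sub_mem mR mQ) (S.mul_mem tmem (S.sub_mem mP mQ))
    refine S.div_mem (S.mul_mem (S.sub_mem m1 tmem) (S.add_mem (S.mul_mem (S.mul_mem (S.mul_mem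
      (S.div_mem hU tmem) ms) mP) (S.sub_mem mQ mR)) (S.mul_mem (S.mul_mem mR (S.sub_mem mQ mP))
      (S.sub_mem m1 tmem)))) (S.mul_mem (S.sub_mem mR mP) (S.sub_mem (S.add_mem
      (S.mul_mem hU ms) m1) tmem))
  have xmem : x ∈ S := by
    rw [eq_div_of_mul_eq hD0 hxD]
    have := S.sub_mem m1 tmem
    exact S.div_mem (S.add_mem (S.sub_mem (S.mul_mem (S.sub_mem mR (S.mul_mem tmem mP))
      (pow_mem ymem 2)) (S.mul_mem (S.mul_mem (S.mul_mem mQ (S.add_mem mP mR)) this) ymem))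
      (S.mul_mem (S.mul_mem (S.mul_mem mP mQ) mR) this))
      (S.add_mem (S.sub_mem (S.mul_mem this (pow_mem ymem 2)) (S.mul_mem (S.sub_mem
      (S.add_mem mP mQ) (S.mul_mem tmem (S.add_mem mR mQ))) ymem)) (S.mul_mem (S.mul_mem mP mR) this))
  refine ⟨xmem, ?_⟩
  have : w = y / x := by rw [hy]; field_simp
  rw [this]
  exact S.div_mem ymem xmem

end Recovery

/-- `u / (1 + u) ^ 2` is invariant under `u ↦ u⁻¹`, so it vanishes wherever `u` is `0` or `∞`. Its
powers can therefore absorb poles along both kinds of fibre at once. -/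
lemma div_one_add_sq_lt_one {K Γ : Type*} [Field K] [LinearOrderedCommGroupWithZero Γ]
    {v : Valuation K Γ} {U : K} (h : v U < 1 ∨ v U⁻¹ < 1) : v (U / (1 + U) ^ 2) < 1 := by
  have key : ∀ u : K, v u < 1 → v (u / (1 + u) ^ 2) < 1 := by
    intro u hu
    have h1 : v (1 + u) = 1 := (ResidueEq.one.add (ResidueEq.of_lt_one hu)).eq_one (by simp)
    rw [map_div₀, map_pow, h1, one_pow, div_one]; exact hu
  rcases h with h | h
  · exact key U h
  · by_cases h0 : U = 0
    · simp [h0]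
    · have := key _ h
      have e : U⁻¹ / (1 + U⁻¹) ^ 2 = U / (1 + U) ^ 2 := by
        have : 1 + U⁻¹ = (1 + U) / U := by field_simp; ring
        rw [this, div_pow]; field_simp
      rwa [e] at this

/-! ### Nonvanishing tested along the fibre `x = p` -/

section FibreP

variable {K Γ : Type*} [Field K] [Algebra ℂ K] [LinearOrderedCommGroupWithZero Γ]
  {v : Valuation K Γ} {p q r : ℂ} {x w : K}

/-- The two members differ by `(r - p) x ^ 2 w (w - 1)`, a unit along this fibre. -/
lemma conicMember_fibre_p (hv : TrivialOnConstants v) (h : RulingConstants p q r)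
    (hx : v (x - algebraMap ℂ K p) < 1) (hw : ResidueNonconstant v w) :
    v (conicMember r q p x w) = 1 ∧
      v (1 - conicMember p q r x w / conicMember r q p x w) = 1 := by
  have hx' := ResidueEq.of_right_le (hv p h.p0).le hx
  have hw' := ResidueEq.refl hw.eq_one.le
  have h1 : v (conicMember r q p x w) = 1 := by
    refine (hx'.conicMember hv hw').eq_one ?_
    have e : conicMember r q p (algebraMap ℂ K p) w = -(algebraMap ℂ K p * algebraMap ℂ K r *
        (algebraMap ℂ K p - algebraMap ℂ K q) * (w - algebraMap ℂ K 1)) := by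
      rw [conicMember, map_one]; ring
    rw [e, Valuation.map_neg]
    simp only [map_mul, hv p h.p0, hv r h.r0, hv.sub h.pq, hw 1, mul_one]
  refine ⟨h1, ?_⟩
  have h0 : conicMember r q p x w ≠ 0 := by intro hz; simp [hz] at h1
  have e : 1 - conicMember p q r x w / conicMember r q p x w =
      -((algebraMap ℂ K p - algebraMap ℂ K r) * x ^ 2 * w * (w - algebraMap ℂ K 1)) /
        conicMember r q p x w := by
    rw [eq_div_iff h0, sub_mul, div_mul_cancel₀ _ h0, one_mul, conicMember, conicMember, map_one]
    ring
  rw [e, map_div₀, h1, div_one, Valuation.map_neg]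
  simp only [map_mul, map_pow, hv.sub h.pr, hx'.eq_one (hv p h.p0), hw.eq_one, hw 1, one_pow, mul_one]

lemma mul_sub_fibre_p (hv : TrivialOnConstants v) (h : RulingConstants p q r)
    (hx : v (x - algebraMap ℂ K p) < 1) (hw : ResidueNonconstant v w) (c : ℂ) :
    v (x * w - algebraMap ℂ K c) = 1 := by
  have hx' := ResidueEq.of_right_le (hv p h.p0).le hx
  refine ((hx'.mul (ResidueEq.refl hw.eq_one.le)).sub (hv.residueEq c)).eq_one ?_
  have := hw.linear hv (a := p) (b := -c) (Or.inl h.p0)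
  rwa [map_neg, ← sub_eq_add_neg] at this

/-- These values serve to show that elements of the field are nonzero, for which one valuation
suffices. Since `U` vanishes along this fibre, the residues are `1 - t`, `-1`, `1` and `1 - t`,
where `t` is the quotient of the two members. -/
lemma fibreParam_fibre_p (hv : TrivialOnConstants v) (h : RulingConstants p q r)
    (hx : v (x - algebraMap ℂ K p) < 1) (hw : ResidueNonconstant v w) :
    v (fibreParam p q r x w) = 1 ∧
    v ((algebraMap ℂ K q - algebraMap ℂ K p) * rulingParam p q r x w - 1) = 1 ∧
    v (1 + rulingParam p q r x w) = 1 ∧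
    v (rulingParam p q r x w * (algebraMap ℂ K r - algebraMap ℂ K q -
      conicMember p q r x w / conicMember r q p x w * (algebraMap ℂ K p - algebraMap ℂ K q))
      + 1 - conicMember p q r x w / conicMember r q p x w) = 1 := by
  obtain ⟨h1, h2⟩ := conicMember_fibre_p hv h hx hw
  have hU := ResidueEq.of_lt_one (rulingParam_fibre_p hv h hx hw)
  have hx' := ResidueEq.of_right_le (hv p h.p0).le hx
  set t := conicMember p q r x w / conicMember r q p x w with ht
  have ht' : ResidueEq v t t := by
    refine ResidueEq.refl ?_
    rw [ht, map_div₀, h1, div_one]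
    exact (hx'.conicMember hv (ResidueEq.refl hw.eq_one.le)).left_le
  refine ⟨?_, ?_, ?_, ?_⟩
  · rw [fibreParam, ← ht]
    refine ((ht'.mul ((((hv.residueEq q).sub (hv.residueEq p)).mul hU).sub ResidueEq.one)).sub
      ((((hv.residueEq q).sub (hv.residueEq r)).mul hU).sub ResidueEq.one)).eq_one ?_
    rw [← h2]; congr 1; ring
  · refine ((((hv.residueEq q).sub (hv.residueEq p)).mul hU).sub ResidueEq.one).eq_one ?_
    rw [mul_zero, zero_sub, Valuation.map_neg, map_one]
  · refine (ResidueEq.one.add hU).eq_one ?_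
    simp
  · refine (((hU.mul (((hv.residueEq r).sub (hv.residueEq q)).sub (ht'.mul ((hv.residueEq p).sub
      (hv.residueEq q))))).add ResidueEq.one).sub ht').eq_one ?_
    rw [zero_mul, zero_add]; exact h2

end FibreP

/-! ### Lines in normal form and their valuations -/

section NormalForm

/-- A configuration of nine lines with a point of multiplicity six and a triple point that are
joined by the first of the lines, in adapted coordinates. -/
def normalLines (ex ey ez : Fin 3 → ℂ) (a : Fin 5 → ℂ) : Fin 9 → Fin 3 → ℂ :=
  ![ez, ex - a 0 • ez, ex - a 1 • ez, ex - a 2 • ez, ex - a 3 • ez, ex - a 4 • ez,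
    ey, ey - ez, ey - ex]

variable {ex ey ez : Fin 3 → ℂ}

/-- The vectors are linearly independent. -/
def Independent (ex ey ez : Fin 3 → ℂ) : Prop :=
  ∀ α β γ : ℂ, α • ex + β • ey + γ • ez = 0 → α = 0 ∧ β = 0 ∧ γ = 0

lemma Independent.ne_zero (h : Independent ex ey ez) {α β γ : ℂ}
    (h0 : ¬ (α = 0 ∧ β = 0 ∧ γ = 0)) : α • ex + β • ey + γ • ez ≠ 0 := fun e => h0 (h _ _ _ e)

lemma Independent.not_dvd (h : Independent ex ey ez) {α β γ α' β' γ' : ℂ}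
    (h0 : ∀ c : ℂ, ¬ (α' = c * α ∧ β' = c * β ∧ γ' = c * γ)) :
    ¬ linForm (α • ex + β • ey + γ • ez) ∣ linForm (α' • ex + β' • ey + γ' • ez) := by
  intro hd
  have hb : α' • ex + β' • ey + γ' • ez ≠ 0 := h.ne_zero (by simpa using h0 0)
  obtain ⟨c, hc⟩ := linForm_dvd_linForm hb hd
  apply h0 c
  have := h (α' - c * α) (β' - c * β) (γ' - c * γ) (by
    rw [← sub_eq_zero] at hc
    rw [← hc]; module)
  simpa [sub_eq_zero] using this

end NormalForm

section LineValuations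

/-- The inclusion of the polynomials in their fraction field. -/
noncomputable abbrev toCone : MvPolynomial (Fin 3) ℂ →+* ConeField := algebraMap _ ConeField

/-- The valuation of a line. -/
noncomputable abbrev lineValuation {u : Fin 3 → ℂ} (hu : u ≠ 0) :=
  (primeValuationSubring ConeField (linForm_prime hu)).valuation

lemma toCone_C (c : ℂ) : toCone (C c) = algebraMap ℂ ConeField c :=
  (IsScalarTower.algebraMap_apply ℂ PolyRing ConeField c).symm

lemma lineValuation_trivialOnConstants {u : Fin 3 → ℂ} (hu : u ≠ 0) :
    TrivialOnConstants (lineValuation hu) := by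
  intro c hc
  rw [← toCone_C]
  refine primeValuation_algebraMap_eq_one _ fun hd => (linForm_prime hu).not_isUnit ?_
  exact isUnit_of_dvd_unit hd ((isUnit_iff_ne_zero.2 hc).map C)

lemma toCone_linForm (ex ey ez : Fin 3 → ℂ) (α β γ : ℂ) :
    toCone (linForm (α • ex + β • ey + γ • ez)) = algebraMap ℂ ConeField α * toCone (linForm ex) +
      algebraMap ℂ ConeField β * toCone (linForm ey) +
      algebraMap ℂ ConeField γ * toCone (linForm ez) := by
  simp only [linForm_add, linForm_smul, map_add, map_mul, toCone_C]

lemma toCone_linForm_ne_zero {u : Fin 3 → ℂ} (hu : u ≠ 0) : toCone (linForm u) ≠ 0 := fun h =>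
  linForm_eq_zero.not.2 hu (IsFractionRing.injective PolyRing ConeField (by rw [h, map_zero]))

variable {ex ey ez u : Fin 3 → ℂ} (h : Independent ex ey ez) (hu : u ≠ 0)

include h in
lemma lineValuation_linForm {α β γ α' β' γ' : ℂ} (e : u = α • ex + β • ey + γ • ez)
    (h0 : ∀ c : ℂ, ¬ (α' = c * α ∧ β' = c * β ∧ γ' = c * γ)) :
    lineValuation hu (algebraMap ℂ ConeField α' * toCone (linForm ex) +
      algebraMap ℂ ConeField β' * toCone (linForm ey) +
      algebraMap ℂ ConeField γ' * toCone (linForm ez)) = 1 := by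
  rw [← toCone_linForm]
  refine primeValuation_algebraMap_eq_one _ ?_
  rw [e]
  exact h.not_dvd h0

lemma lineValuation_self {α β γ : ℂ} (e : u = α • ex + β • ey + γ • ez) :
    lineValuation hu (algebraMap ℂ ConeField α * toCone (linForm ex) +
      algebraMap ℂ ConeField β * toCone (linForm ey) +
      algebraMap ℂ ConeField γ * toCone (linForm ez)) < 1 := by
  rw [← toCone_linForm, ← e]
  exact primeValuation_self_lt_one _

include h in
lemma lineValuation_fibre {c : ℂ} (e : u = ex - c • ez) :
    lineValuation hu (toCone (linForm ex) / toCone (linForm ez) - algebraMap ℂ ConeField c) < 1 ∧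
      ResidueNonconstant (lineValuation hu) (toCone (linForm ey) / toCone (linForm ez)) := by
  have e' : u = (1 : ℂ) • ex + (0 : ℂ) • ey + (-c) • ez := by rw [e]; module
  have hz : lineValuation hu (toCone (linForm ez)) = 1 := by
    have := lineValuation_linForm h hu (α' := 0) (β' := 0) (γ' := 1) e' (by
      rintro d ⟨h1, -, h3⟩; simp at h1; simp [← h1] at h3)
    simpa using this
  have hz0 : toCone (linForm ez) ≠ 0 := by intro hh; simp [hh] at hz
  refine ⟨?_, fun d => ?_⟩
  · have := lineValuation_self hu e'
    rw [div_sub' hz0, map_div₀, hz, div_one]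
    simpa [sub_eq_add_neg, mul_comm] using this
  · have := lineValuation_linForm h hu (α' := 0) (β' := 1) (γ' := -d) e' (by
      rintro d ⟨-, h2, -⟩; simp at h2)
    rw [div_sub' hz0, map_div₀, hz, div_one]
    simpa [sub_eq_add_neg, mul_comm] using this

include h in
-- `β ≠ 0` says that the line misses the point `ex = ez = 0`, so the pencil of lines through that
-- point cuts out a nonconstant function on it.
lemma lineValuation_section {α β γ : ℂ} (e : u = α • ex + β • ey + γ • ez) (hβ : β ≠ 0) :
    lineValuation hu (toCone (linForm ez)) = 1 ∧
      ResidueNonconstant (lineValuation hu) (toCone (linForm ex) / toCone (linForm ez)) := by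
  have hz : lineValuation hu (toCone (linForm ez)) = 1 := by
    have := lineValuation_linForm h hu (α' := 0) (β' := 0) (γ' := 1) e (by
      rintro d ⟨-, h2, h3⟩
      rcases mul_eq_zero.1 h2.symm with h2 | h2
      · simp [h2] at h3
      · exact hβ h2)
    simpa using this
  have hz0 : toCone (linForm ez) ≠ 0 := by intro hh; simp [hh] at hz
  refine ⟨hz, fun d => ?_⟩
  have := lineValuation_linForm h hu (α' := 1) (β' := 0) (γ' := -d) e (by
    rintro d ⟨h1, h2, -⟩
    rcases mul_eq_zero.1 h2.symm with h2 | h2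
    · simp [h2] at h1
    · exact hβ h2)
  rw [div_sub' hz0, map_div₀, hz, div_one]
  simpa [sub_eq_add_neg, mul_comm] using this

include h in
lemma lineValuation_section_zero (e : u = ey) :
    lineValuation hu (toCone (linForm ey) / toCone (linForm ez)) < 1 ∧
      ResidueNonconstant (lineValuation hu) (toCone (linForm ex) / toCone (linForm ez)) := by
  have e' : u = (0 : ℂ) • ex + (1 : ℂ) • ey + (0 : ℂ) • ez := by rw [e]; module
  obtain ⟨hz, hn⟩ := lineValuation_section h hu e' one_ne_zero
  refine ⟨?_, hn⟩
  rw [map_div₀, hz, div_one]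
  simpa using lineValuation_self hu e'

include h in
lemma lineValuation_section_infty (e : u = ey - ez) :
    lineValuation hu (toCone (linForm ey) / toCone (linForm ez) - 1) < 1 ∧
      ResidueNonconstant (lineValuation hu) (toCone (linForm ex) / toCone (linForm ez)) := by
  have e' : u = (0 : ℂ) • ex + (1 : ℂ) • ey + (-1 : ℂ) • ez := by rw [e]; module
  obtain ⟨hz, hn⟩ := lineValuation_section h hu e' one_ne_zero
  have hz0 : toCone (linForm ez) ≠ 0 := by intro hh; simp [hh] at hz
  refine ⟨?_, hn⟩
  rw [div_sub' hz0, map_div₀, hz, div_one]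
  simpa [sub_eq_add_neg] using lineValuation_self hu e'

include h in
lemma lineValuation_section_one (e : u = ey - ex) :
    lineValuation hu (toCone (linForm ex) / toCone (linForm ez)
      - toCone (linForm ey) / toCone (linForm ez)) < 1 ∧
      ResidueNonconstant (lineValuation hu) (toCone (linForm ex) / toCone (linForm ez)) := by
  have e' : u = (-1 : ℂ) • ex + (1 : ℂ) • ey + (0 : ℂ) • ez := by rw [e]; module
  obtain ⟨hz, hn⟩ := lineValuation_section h hu e' one_ne_zero
  refine ⟨?_, hn⟩
  rw [← sub_div, map_div₀, hz, div_one, ← Valuation.map_neg]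
  have := lineValuation_self hu e'
  convert this using 2
  simp; ring

include h in
lemma lineValuation_infty (e : u = ez) :
    lineValuation hu (toCone (linForm ex) / toCone (linForm ez))⁻¹ < 1 ∧
    lineValuation hu (toCone (linForm ey) / toCone (linForm ez))⁻¹ < 1 := by
  have e' : u = (0 : ℂ) • ex + (0 : ℂ) • ey + (1 : ℂ) • ez := by rw [e]; module
  have hz : lineValuation hu (toCone (linForm ez)) < 1 := by
    simpa using lineValuation_self hu e'
  have hx := lineValuation_linForm h hu (α' := 1) (β' := 0) (γ' := 0) e' (by simp)
  have hy := lineValuation_linForm h hu (α' := 0) (β' := 1) (γ' := 0) e' (by simp)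
  simp only [map_one, map_zero, one_mul, zero_mul, add_zero, zero_add] at hx hy
  exact ⟨by rw [inv_div, map_div₀, hx, div_one]; exact hz,
    by rw [inv_div, map_div₀, hy, div_one]; exact hz⟩

lemma linForm_dvd_of_lineValuation_lt_one {f g : MvPolynomial (Fin 3) ℂ} {φ : ConeField}
    (hφ : lineValuation hu φ < 1) (hfg : toCone f = φ * toCone g) : linForm u ∣ f := by
  by_contra hd
  have h1 : lineValuation hu (toCone f) = 1 := primeValuation_algebraMap_eq_one _ hd
  rw [hfg, map_mul] at h1
  exact (mul_lt_one_of_lt_of_le hφ (primeValuation_algebraMap_le_one _ g)).ne h1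

end LineValuations

/-- A rational parametrisation of the plane whose coordinates vanish along nine given lines gives
a Cremona transformation that contracts them. -/
lemma exists_cremonaMap_dvd (u : Fin 9 → Fin 3 → ℂ) (hu : ∀ i, u i ≠ 0) {φ ψ : ConeField}
    (hφ : φ ∈ ratioField fun i => toCone (X i)) (hψ : ψ ∈ ratioField fun i => toCone (X i))
    (hgen : ∀ i, toCone (X i) / toCone (X 0) ∈ ratioField ![1, φ, ψ])
    (hφ1 : ∀ i, lineValuation (hu i) φ < 1) (hψ1 : ∀ i, lineValuation (hu i) ψ < 1) :
    ∃ γ : CremonaMap, ∀ i, linForm (u i) ∣ γ.form 1 ∧ linForm (u i) ∣ γ.form 2 := by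
  obtain ⟨γ, -, h1, h2⟩ := exists_cremonaMap hφ hψ hgen
  exact ⟨γ, fun i => ⟨linForm_dvd_of_lineValuation_lt_one (hu i) (hφ1 i) h1,
    linForm_dvd_of_lineValuation_lt_one (hu i) (hψ1 i) h2⟩⟩

/-- On the curve only the coordinate of index `0` survives, so the image is `[1 : 0 : 0]`. -/
lemma CremonaMap.contracts_of_dvd (γ : CremonaMap) {p : MvPolynomial (Fin 3) ℂ}
    (h1 : p ∣ γ.form 1) (h2 : p ∣ γ.form 2) : γ.Contracts p := by
  have hne : (![1, 0, 0] : Fin 3 → ℂ) ≠ 0 := fun h => by simpa using congrFun h 0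
  refine ⟨Projectivization.mk ℂ ![1, 0, 0] hne, fun v _ hv h => ?_⟩
  rw [Projectivization.mk_eq_mk_iff']
  have e : ∀ i, p ∣ γ.form i → γ.value v i = 0 := by
    rintro i ⟨q, hq⟩
    rw [CremonaMap.value, hq, map_mul, hv, zero_mul]
  refine ⟨γ.value v 0, ?_⟩
  funext i
  fin_cases i
  · simp
  · simp [e 1 h1]
  · simp [e 2 h2]

/-! ### The contracting Cremona transformation -/

section Core

variable {ex ey ez : Fin 3 → ℂ}

lemma Independent.exists_combination (h : Independent ex ey ez) (b : Fin 3 → ℂ) :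
    ∃ α β γ : ℂ, b = α • ex + β • ey + γ • ez := by
  have hli : LinearIndependent ℂ ![ex, ey, ez] := by
    rw [Fintype.linearIndependent_iff]
    intro g hg
    rw [Fin.sum_univ_three] at hg
    obtain ⟨h0, h1, h2⟩ := h _ _ _ hg
    intro i
    fin_cases i
    exacts [h0, h1, h2]
  have hspan := hli.span_eq_top_of_card_eq_finrank (by simp)
  have hb : b ∈ Submodule.span ℂ (Set.range ![ex, ey, ez]) := hspan ▸ Submodule.mem_top
  obtain ⟨c, hc⟩ := (Submodule.mem_span_range_iff_exists_fun ℂ).1 hb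
  rw [Fin.sum_univ_three] at hc
  exact ⟨c 0, c 1, c 2, hc.symm⟩

lemma normalLines_ne_zero (h : Independent ex ey ez) (a : Fin 5 → ℂ) (i : Fin 9) :
    normalLines ex ey ez a i ≠ 0 := by
  have hz : ez ≠ 0 := by
    have := h.ne_zero (α := 0) (β := 0) (γ := 1) (by simp); simpa using this
  have hx : ∀ c : ℂ, ex - c • ez ≠ 0 := by
    intro c
    have := h.ne_zero (α := 1) (β := 0) (γ := -c) (by simp)
    simpa [sub_eq_add_neg] using this
  have hy : ∀ c d : ℂ, c • ex + (1 : ℂ) • ey + d • ez ≠ 0 := fun c d => h.ne_zero (by simp)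
  fin_cases i
  · exact hz
  · exact hx _
  · exact hx _
  · exact hx _
  · exact hx _
  · exact hx _
  · simpa [normalLines] using hy 0 0
  · simpa [normalLines, sub_eq_add_neg] using hy 0 (-1)
  · simpa [normalLines, sub_eq_add_neg, add_comm] using hy (-1) 0

lemma mem_of_pencilCoord_mem {K : Type*} [Field K] [Algebra ℂ K] (S : IntermediateField ℂ K)
    {a b : ℂ} (hab : a ≠ b) {ξ : K} (hξ : ξ ≠ algebraMap ℂ K a)
    (h : pencilCoord a b ξ ∈ S) : ξ ∈ S := by
  have h0 : ξ - algebraMap ℂ K a ≠ 0 := sub_ne_zero.2 hξ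
  have e1 : pencilCoord a b ξ * (ξ - algebraMap ℂ K a) = ξ - algebraMap ℂ K b := by
    rw [pencilCoord]; field_simp
  have h1 : pencilCoord a b ξ - 1 ≠ 0 := by
    intro hz
    rw [sub_eq_zero] at hz
    rw [hz, one_mul, sub_right_inj] at e1
    exact hab ((algebraMap ℂ K).injective e1)
  have e2 : ξ * (pencilCoord a b ξ - 1) =
      pencilCoord a b ξ * algebraMap ℂ K a - algebraMap ℂ K b := by
    linear_combination e1
  rw [eq_div_of_mul_eq h1 e2]
  exact S.div_mem (S.sub_mem (S.mul_mem h (S.algebraMap_mem a)) (S.algebraMap_mem b))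
    (S.sub_mem h S.one_mem)

lemma mem_of_crossCoord_mem {K : Type*} [Field K] [Algebra ℂ K] (S : IntermediateField ℂ K)
    {ξ η : K} (h0 : ξ ≠ 0) (h1 : ξ ≠ 1) (hη : η ≠ 1) (hξ : ξ ∈ S)
    (h : crossCoord ξ η ∈ S) : η ∈ S := by
  have h1' : ξ - 1 ≠ 0 := sub_ne_zero.2 h1
  have hη' : η - 1 ≠ 0 := sub_ne_zero.2 hη
  have e1 : crossCoord ξ η * ((η - 1) * ξ) = η * (ξ - 1) := by
    rw [crossCoord]; field_simp
  set w := crossCoord ξ η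
  have e2 : η * (w * ξ - (ξ - 1)) = w * ξ := by linear_combination e1
  have h2 : w * ξ - (ξ - 1) ≠ 0 := by
    intro hz
    apply h1'
    linear_combination (η - 1) * hz - e1
  rw [eq_div_of_mul_eq h2 e2]
  exact S.div_mem (S.mul_mem h hξ) (S.sub_mem (S.mul_mem h hξ) (S.sub_mem hξ S.one_mem))

/-- The residues of the parameters of the ruling along the six lines through the point of
multiplicity six. -/
lemma rulingConstants {a : Fin 5 → ℂ} (ha : Function.Injective a) :
    RulingConstants ((a 2 - a 1) / (a 2 - a 0)) ((a 3 - a 1) / (a 3 - a 0))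
      ((a 4 - a 1) / (a 4 - a 0)) := by
  have hne : ∀ i j, i ≠ j → a i - a j ≠ 0 := fun i j h => sub_ne_zero.2 (ha.ne h)
  have h10 := hne 1 0 (by decide)
  have inj : ∀ i j, i ≠ j → a i - a 0 ≠ 0 → a j - a 0 ≠ 0 →
      (a i - a 1) / (a i - a 0) ≠ (a j - a 1) / (a j - a 0) := by
    intro i j hij hi hj h
    rw [div_eq_div_iff hi hj] at h
    have : (a 1 - a 0) * (a i - a j) = 0 := by linear_combination h
    exact (mul_ne_zero h10 (hne i j hij)) this
  have one : ∀ i, a i - a 0 ≠ 0 → (a i - a 1) / (a i - a 0) ≠ 1 := by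
    intro i hi h
    rw [div_eq_one_iff_eq hi] at h
    exact h10 (by linear_combination -h)
  have h20 := hne 2 0 (by decide)
  have h30 := hne 3 0 (by decide)
  have h40 := hne 4 0 (by decide)
  exact ⟨div_ne_zero (hne 2 1 (by decide)) h20, div_ne_zero (hne 3 1 (by decide)) h30,
    div_ne_zero (hne 4 1 (by decide)) h40, one 2 h20, one 3 h30, one 4 h40,
    inj 2 3 (by decide) h20 h30, inj 2 4 (by decide) h20 h40, inj 3 4 (by decide) h30 h40⟩

/-- The nine lines are contracted by a Cremona transformation. -/
theorem exists_cremonaMap_normalLines (h : Independent ex ey ez) {a : Fin 5 → ℂ}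
    (ha : Function.Injective a) (ha0 : ∀ i, a i ≠ 0) (ha1 : ∀ i, a i ≠ 1) :
    ∃ γ : CremonaMap, ∀ i, linForm (normalLines ex ey ez a i) ∣ γ.form 1 ∧
      linForm (normalLines ex ey ez a i) ∣ γ.form 2 := by
  have hu := normalLines_ne_zero h a
  have hR := rulingConstants ha
  set p := (a 2 - a 1) / (a 2 - a 0) with hp
  set q := (a 3 - a 1) / (a 3 - a 0) with hq
  set r := (a 4 - a 1) / (a 4 - a 0) with hr
  have h01 : a 0 ≠ a 1 := ha.ne (by decide)
  set ξ : ConeField := toCone (linForm ex) / toCone (linForm ez) with hξ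
  set η : ConeField := toCone (linForm ey) / toCone (linForm ez) with hη
  set x := pencilCoord (a 0) (a 1) ξ with hx
  set w := crossCoord ξ η with hw
  set U := rulingParam p q r x w with hU
  set W := fibreParam p q r x w with hW
  have hv : ∀ i, TrivialOnConstants (lineValuation (hu i)) := fun i =>
    lineValuation_trivialOnConstants (hu i)
  have hez : ez ≠ 0 := hu 0
  have hex : ex ≠ 0 := by
    have := h.ne_zero (α := 1) (β := 0) (γ := 0) (by simp); simpa using this
  have hey : ey ≠ 0 := hu 6
  have hz0 := toCone_linForm_ne_zero hez
  have hξ0 : ξ ≠ 0 := div_ne_zero (toCone_linForm_ne_zero hex) hz0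
  have hη0 : η ≠ 0 := div_ne_zero (toCone_linForm_ne_zero hey) hz0
  obtain ⟨f1, g1⟩ := lineValuation_fibre h (hu 1) (c := a 0) rfl
  obtain ⟨f2, g2⟩ := lineValuation_fibre h (hu 2) (c := a 1) rfl
  obtain ⟨f3, g3⟩ := lineValuation_fibre h (hu 3) (c := a 2) rfl
  obtain ⟨f4, g4⟩ := lineValuation_fibre h (hu 4) (c := a 3) rfl
  obtain ⟨f5, g5⟩ := lineValuation_fibre h (hu 5) (c := a 4) rfl
  obtain ⟨f0, g0⟩ := lineValuation_infty h (hu 0) rfl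
  obtain ⟨f6, g6⟩ := lineValuation_section_zero h (hu 6) rfl
  obtain ⟨f7, g7⟩ := lineValuation_section_infty h (hu 7) rfl
  obtain ⟨f8, g8⟩ := lineValuation_section_one h (hu 8) rfl
  have w3 := crossCoord_nonconstant (hv 3) (ha0 2) (ha1 2) f3 g3
  have w4 := crossCoord_nonconstant (hv 4) (ha0 3) (ha1 3) f4 g4
  have x3 := pencilCoord_residue (a := a 0) (b := a 1) (hv 3) (ha.ne (by decide)) f3
  have x4 := pencilCoord_residue (a := a 0) (b := a 1) (hv 4) (ha.ne (by decide)) f4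
  have x5 := pencilCoord_residue (a := a 0) (b := a 1) (hv 5) (ha.ne (by decide)) f5
  have x7 := pencilCoord_nonconstant (hv 7) h01 g7
  have hN : rulingNum p q r x w ≠ 0 := by
    intro hz
    have := rulingNum_fibre_q (hv 4) hR x4 w4
    rw [hz, map_zero] at this
    exact zero_ne_one this
  have hD : rulingDen p q r x w ≠ 0 := by
    intro hz
    have := rulingDen_fibre_p (hv 3) hR x3 w3
    rw [hz, map_zero] at this
    exact zero_ne_one this
  have hU0 : U ≠ 0 := div_ne_zero hN hD
  -- The line of index `3`, i.e. the fibre `x = p`, is the test valuation for nonvanishing.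
  have nz : ∀ {f : ConeField}, lineValuation (hu 3) f = 1 → f ≠ 0 := by
    rintro f hf rfl
    rw [map_zero] at hf
    exact zero_ne_one hf
  obtain ⟨k1, k2, k3, k4⟩ := fibreParam_fibre_p (hv 3) hR x3 w3
  have hw0 : w ≠ 0 := nz w3.eq_one
  obtain ⟨s1, s2, s3⟩ := section_infty (p := p) (q := q) (r := r) (hv 7) (crossCoord_inv g7 f7)
    hw0 x7
  -- `R` vanishes along the eight lines where `U` is `0` or `∞` and is a unit along the section of
  -- index `7`.
  set R := U / (1 + U) ^ 2 with hRdef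
  have hR0 : R ≠ 0 := div_ne_zero hU0 (pow_ne_zero 2 (nz k3))
  have hR7 : lineValuation (hu 7) R = 1 := by
    rw [hRdef, map_div₀, map_pow, s1, s2]; simp
  have hRsmall : ∀ i, i ≠ 7 → lineValuation (hu i) R < 1 := by
    intro i hi
    apply div_one_add_sq_lt_one
    match i with
    | 0 => exact Or.inl (rulingParam_point_one (hv 0) hR (crossCoord_infty f0 g0 hξ0 hη0)
        (pencilCoord_infty (hv 0) f0 hξ0))
    | 1 => exact Or.inl (rulingParam_fibre_infty (hv 1) (pencilCoord_inv_lt_one (hv 1) h01 f1)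
        (crossCoord_nonconstant (hv 1) (ha0 0) (ha1 0) f1 g1))
    | 2 => exact Or.inl (rulingParam_fibre_zero (hv 2) hR (pencilCoord_lt_one (hv 2) h01 f2)
        (crossCoord_nonconstant (hv 2) (ha0 1) (ha1 1) f2 g2))
    | 3 => exact Or.inl (rulingParam_fibre_p (hv 3) hR x3 w3)
    | 4 => exact Or.inr (rulingParam_fibre_q (hv 4) hR x4 w4)
    | 5 => exact Or.inr (rulingParam_fibre_r (hv 5) hR x5
        (crossCoord_nonconstant (hv 5) (ha0 4) (ha1 4) f5 g5))
    | 6 => exact Or.inl (rulingParam_section_zero (hv 6) hR (crossCoord_zero g6 f6)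
        (pencilCoord_nonconstant (hv 6) h01 g6))
    | 7 => exact absurd rfl hi
    | 8 => exact Or.inl (rulingParam_section_one (hv 8) (crossCoord_one g8 f8)
        (pencilCoord_nonconstant (hv 8) h01 g8))
  -- Along the section `W` already vanishes and `U`, `R` are units, so every `n` works. Along the
  -- other lines a high power of `R` absorbs the poles of `W` and `U W`.
  have hexN : ∀ i, ∃ N : ℕ, ∀ n ≥ N, lineValuation (hu i) (W * R ^ n) < 1 ∧
      lineValuation (hu i) (U * W * R ^ n) < 1 := by
    intro i
    by_cases hi : i = 7
    · subst hi
      refine ⟨0, fun n _ => ?_⟩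
      have hU7 : lineValuation (hu 7) U = 1 := s1
      have hW7 : lineValuation (hu 7) W < 1 := s3
      simp only [map_mul, map_pow, hR7, hU7, one_pow, mul_one, one_mul]
      exact ⟨hW7, hW7⟩
    · obtain ⟨N1, h1⟩ := exists_primeValuation_mul_pow_lt_one (linForm_prime (hu i)) W
        (hRsmall i hi)
      obtain ⟨N2, h2⟩ := exists_primeValuation_mul_pow_lt_one (linForm_prime (hu i)) (U * W)
        (hRsmall i hi)
      exact ⟨max N1 N2, fun n hn => ⟨h1 n ((le_max_left _ _).trans hn),
        h2 n ((le_max_right _ _).trans hn)⟩⟩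
  choose N hN' using hexN
  set n := Finset.univ.sup N
  have hn : ∀ i, N i ≤ n := fun i => Finset.le_sup (Finset.mem_univ i)
  set T := ratioField fun i => toCone (X i) with hT
  have hae : ∀ s : MvPolynomial (Fin 3) ℂ, aeval (fun i => toCone (X i)) s = toCone s := by
    intro s
    have := aeval_algebraMap_apply (A := PolyRing) ConeField (X : Fin 3 → PolyRing) s
    rw [aeval_X_left_apply] at this
    exact this
  have hratio : ∀ b : Fin 3 → ℂ, toCone (linForm b) / toCone (linForm ez) ∈ T := fun b =>
    mem_ratioField.2 ⟨1, linForm b, linForm ez, linForm_isHomogeneous b, linForm_isHomogeneous ez,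
      by rw [hae]; exact hz0, by rw [hae, hae]; exact div_mul_cancel₀ _ hz0⟩
  have const : ∀ (S : IntermediateField ℂ ConeField) (c : ℂ), algebraMap ℂ ConeField c ∈ S :=
    fun S c => S.algebraMap_mem c
  have hxT : x ∈ T := T.div_mem (T.sub_mem (hratio ex) (const T _))
    (T.sub_mem (hratio ex) (const T _))
  have hwT : w ∈ T := T.div_mem (T.mul_mem (hratio ey) (T.sub_mem (hratio ex) T.one_mem))
    (T.mul_mem (T.sub_mem (hratio ey) T.one_mem) (hratio ex))
  have hconT : ∀ p q r : ℂ, conicMember p q r x w ∈ T := by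
    intro p q r
    refine T.add_mem (T.sub_mem (T.mul_mem (T.mul_mem (pow_mem hxT 2) (pow_mem hwT 2))
      (T.sub_mem hxT (const T r))) (T.mul_mem (T.mul_mem hxT hwT) (T.sub_mem (T.mul_mem
      (T.add_mem (const T p) (const T q)) hxT) (T.mul_mem (const T q) (T.add_mem (const T p)
      (const T r)))))) (T.mul_mem (T.mul_mem (const T p) (const T r)) (T.sub_mem hxT (const T q)))
  have hUT : U ∈ T := by
    refine T.div_mem (T.mul_mem (T.mul_mem (T.mul_mem (T.mul_mem (pow_mem hxT 2) hwT)
      (T.sub_mem T.one_mem hwT)) (T.sub_mem hxT (const T p))) (hconT p q r)) ?_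
    exact T.mul_mem (T.mul_mem (T.mul_mem (T.sub_mem hxT (const T q)) (T.sub_mem hxT (const T r)))
      (pow_mem (T.sub_mem (T.mul_mem hxT hwT) (const T p)) 2)) (hconT r q p)
  have hWT : W ∈ T := T.sub_mem (T.mul_mem (T.div_mem (hconT p q r) (hconT r q p)) (T.sub_mem
    (T.mul_mem (T.sub_mem (const T q) (const T p)) hUT) T.one_mem)) (T.sub_mem
    (T.mul_mem (T.sub_mem (const T q) (const T r)) hUT) T.one_mem)
  have hRmem : ∀ S : IntermediateField ℂ ConeField, U ∈ S → R ∈ S := fun S hS =>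
    S.div_mem hS (pow_mem (S.add_mem S.one_mem hS) 2)
  refine exists_cremonaMap_dvd _ hu (φ := U * W * R ^ n) (ψ := W * R ^ n)
    (T.mul_mem (T.mul_mem hUT hWT) (pow_mem (hRmem T hUT) n))
    (T.mul_mem hWT (pow_mem (hRmem T hUT) n)) ?_ (fun i => (hN' i n (hn i)).2)
    (fun i => (hN' i n (hn i)).1)
  set S := ratioField ![1, U * W * R ^ n, W * R ^ n] with hS
  have hψ0 : W * R ^ n ≠ 0 := mul_ne_zero (nz k1) (pow_ne_zero n hR0)
  have hφS : U * W * R ^ n ∈ S := mem_ratioField.2 ⟨1, X 1, X 0, isHomogeneous_X _ _,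
    isHomogeneous_X _ _, by simp, by simp⟩
  have hψS : W * R ^ n ∈ S := mem_ratioField.2 ⟨1, X 2, X 0, isHomogeneous_X _ _,
    isHomogeneous_X _ _, by simp, by simp⟩
  -- `U = φ / ψ`; this puts `R` in `S`, and then `W = ψ / R ^ n`.
  have hUS : U ∈ S := by
    have : U = (U * W * R ^ n) / (W * R ^ n) := by rw [eq_div_iff hψ0]; ring
    rw [this]; exact S.div_mem hφS hψS
  have hWS : W ∈ S := by
    have : W = (W * R ^ n) / R ^ n := by rw [eq_div_iff (pow_ne_zero n hR0)]
    rw [this]; exact S.div_mem hψS (pow_mem (hRmem S hUS) n)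
  obtain ⟨hxS, hwS⟩ := mem_of_ruling_mem S hR rfl hU hN hD (nz k2) (nz k4)
    (nz (mul_sub_fibre_p (hv 3) hR x3 w3 q)) (nz (mul_sub_fibre_p (hv 3) hR x3 w3 r)) hUS hWS
  have nz7 : ∀ c : ℂ, ξ - algebraMap ℂ ConeField c ≠ 0 := by
    intro c hz
    have := g7 c
    rw [hz, map_zero] at this
    exact zero_ne_one this
  have hξS : ξ ∈ S := mem_of_pencilCoord_mem S h01 (sub_ne_zero.1 (nz7 _)) hxS
  have hηS : η ∈ S := by
    refine mem_of_crossCoord_mem S hξ0 ?_ ?_ hξS hwS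
    · have := nz7 1
      rw [map_one] at this
      exact sub_ne_zero.1 this
    · have := nz (g3 1)
      rw [map_one] at this
      exact sub_ne_zero.1 this
  have hlin : ∀ i : Fin 3, toCone (X i) / toCone (linForm ez) ∈ S := by
    intro i
    obtain ⟨α, β, γ, e⟩ := h.exists_combination (Pi.single i 1)
    have hX : (X i : MvPolynomial (Fin 3) ℂ) = linForm (Pi.single i 1) := by
      simp [linForm, Pi.single_apply]
    have : toCone (X i) / toCone (linForm ez) = algebraMap ℂ ConeField α * ξ +
        algebraMap ℂ ConeField β * η + algebraMap ℂ ConeField γ := by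
      rw [hX, e, toCone_linForm, hξ, hη]; field_simp
    rw [this]
    exact S.add_mem (S.add_mem (S.mul_mem (const S α) hξS) (S.mul_mem (const S β) hηS)) (const S γ)
  intro i
  rw [← div_div_div_cancel_right₀ hz0]
  exact S.div_mem (hlin i) (hlin 0)

end Core

/-! ### From the incidences to the normal form -/

section Incidence

lemma through_iff {ℓ : PlaneLine} {P : Plane} : ℓ.Through P ↔ ℓ.rep ⬝ᵥ P.rep = 0 := by
  rw [PlaneLine.Through]
  conv_lhs => rw [← ℓ.mk_rep, ← P.mk_rep]
  exact Projectivization.orthogonal_mk _ _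

lemma through_mk_iff {ℓ : PlaneLine} {v : Fin 3 → ℂ} (hv : v ≠ 0) :
    ℓ.Through (Projectivization.mk ℂ v hv) ↔ ℓ.rep ⬝ᵥ v = 0 := by
  rw [PlaneLine.Through]
  conv_lhs => rw [← ℓ.mk_rep]
  exact Projectivization.orthogonal_mk _ _

lemma eq_of_rep_eq_smul {ℓ ℓ' : ℙ ℂ (Fin 3 → ℂ)} {c : ℂ} (h : ℓ.rep = c • ℓ'.rep) : ℓ = ℓ' := by
  rw [← ℓ.mk_rep, ← ℓ'.mk_rep, Projectivization.mk_eq_mk_iff']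
  exact ⟨c, h.symm⟩

lemma exists_ne_zero_orthogonal_pair (u v : Fin 3 → ℂ) :
    ∃ w : Fin 3 → ℂ, w ≠ 0 ∧ u ⬝ᵥ w = 0 ∧ v ⬝ᵥ w = 0 := by
  -- Repeating the row `v` gives a singular `3 × 3` matrix, and any kernel vector will do.
  obtain ⟨w, hw, h⟩ := Matrix.exists_mulVec_eq_zero_iff.2
    (Matrix.det_zero_of_row_eq (M := !![u 0, u 1, u 2; v 0, v 1, v 2; v 0, v 1, v 2])
      (i := 1) (j := 2) (by decide) (by ext j; fin_cases j <;> simp))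
  refine ⟨w, hw, ?_, ?_⟩
  · have := congrFun h 0
    simpa [Matrix.mulVec, dotProduct, Fin.sum_univ_three] using this
  · have := congrFun h 1
    simpa [Matrix.mulVec, dotProduct, Fin.sum_univ_three] using this

/-- The lines through a point form a pencil. -/
lemma exists_combination_of_dotProduct_eq_zero {P u v w : Fin 3 → ℂ} (hP : P ≠ 0)
    (hu : u ⬝ᵥ P = 0) (hv : v ⬝ᵥ P = 0) (hw : w ⬝ᵥ P = 0) (hu0 : u ≠ 0)
    (huv : ∀ c : ℂ, v ≠ c • u) : ∃ α β : ℂ, w = α • u + β • v := by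
  have hdet : (Matrix.of ![u, v, w]).det = 0 := by
    rw [← Matrix.exists_mulVec_eq_zero_iff]
    refine ⟨P, hP, ?_⟩
    ext i
    fin_cases i
    exacts [hu, hv, hw]
  obtain ⟨c, hc0, hc⟩ := Matrix.exists_vecMul_eq_zero_iff.2 hdet
  have hc' : c 0 • u + c 1 • v + c 2 • w = 0 := by
    rw [← hc]
    ext j
    simp [Matrix.vecMul, dotProduct, Fin.sum_univ_three]
  -- `c 2 = 0` would leave a nontrivial relation between `u` and `v` alone.
  have h2 : c 2 ≠ 0 := by
    intro h2
    rw [h2, zero_smul, add_zero] at hc'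
    by_cases h1 : c 1 = 0
    · rw [h1, zero_smul, add_zero] at hc'
      rcases smul_eq_zero.1 hc' with h0 | h0
      · apply hc0
        ext i
        fin_cases i
        exacts [h0, h1, h2]
      · exact hu0 h0
    · apply huv (-(c 0 / c 1))
      have : c 1 • v = -(c 0 • u) := eq_neg_of_add_eq_zero_right hc'
      rw [← inv_smul_smul₀ h1 v, this, smul_neg, smul_smul, neg_smul, div_eq_inv_mul]
  refine ⟨-(c 0 / c 2), -(c 1 / c 2), ?_⟩
  have : c 2 • w = -(c 0 • u + c 1 • v) := eq_neg_of_add_eq_zero_right hc'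
  rw [← inv_smul_smul₀ h2 w, this]
  simp only [smul_neg, smul_add, smul_smul, neg_smul, div_eq_inv_mul]
  abel

lemma HasConfiguration.exists_point {d : ℕ} {L : Fin d → PlaneLine} {B : Finset (Finset (Fin d))}
    (h : HasConfiguration L B) {I : Finset (Fin d)} (hI : I ∈ B) :
    ∃ P : Plane, ∀ i, i ∈ I ↔ (L i).rep ⬝ᵥ P.rep = 0 := by
  obtain ⟨-, P, hP⟩ := (h.2 I).1 hI
  exact ⟨P, fun i => (hP i).trans through_iff⟩

/-- Three concurrent lines of a configuration belong to one of its blocks. -/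
lemma HasConfiguration.exists_block {d : ℕ} {L : Fin d → PlaneLine}
    {B : Finset (Finset (Fin d))} (h : HasConfiguration L B) {v : Fin 3 → ℂ} (hv : v ≠ 0)
    {i j k : Fin d} (hij : i ≠ j) (hik : i ≠ k) (hjk : j ≠ k) (hi : (L i).rep ⬝ᵥ v = 0)
    (hj : (L j).rep ⬝ᵥ v = 0) (hk : (L k).rep ⬝ᵥ v = 0) :
    ∃ I ∈ B, i ∈ I ∧ j ∈ I ∧ k ∈ I := by
  classical
  set P := Projectivization.mk ℂ v hv
  set I := Finset.univ.filter fun i => (L i).Through P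
  have mem : ∀ i, (L i).rep ⬝ᵥ v = 0 → i ∈ I := fun i hi =>
    Finset.mem_filter.2 ⟨Finset.mem_univ _, (through_mk_iff hv).2 hi⟩
  refine ⟨I, (h.2 I).2 ⟨?_, P, fun i => by simp [I]⟩, mem i hi, mem j hj, mem k hk⟩
  have : ({i, j, k} : Finset (Fin d)) ⊆ I := by
    intro l hl
    simp only [Finset.mem_insert, Finset.mem_singleton] at hl
    rcases hl with rfl | rfl | rfl
    exacts [mem _ hi, mem _ hj, mem _ hk]
  exact (Finset.card_eq_three.2 ⟨i, j, k, hij, hik, hjk, rfl⟩).ge.trans (Finset.card_le_card this)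

lemma HasConfiguration.rep_ne_smul {d : ℕ} {L : Fin d → PlaneLine}
    {B : Finset (Finset (Fin d))} (h : HasConfiguration L B) {i j : Fin d} (hij : i ≠ j) (c : ℂ) :
    (L i).rep ≠ c • (L j).rep := fun e => hij (h.1 (eq_of_rep_eq_smul e))

/-- Adapted coordinates for a configuration whose point of multiplicity six and triple point are
joined by one of its lines. -/
lemma exists_normalLines {L : Fin 9 → PlaneLine}
    (h : HasConfiguration L {{0, 1, 2, 3, 4, 5}, {0, 6, 7}}) :
    ∃ (ex ey ez : Fin 3 → ℂ) (a : Fin 5 → ℂ), Independent ex ey ez ∧ Function.Injective a ∧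
      (∀ i, a i ≠ 0) ∧ (∀ i, a i ≠ 1) ∧
      ∀ i, ∃ c : ℂ, (L i).rep = c • normalLines ex ey ez a i := by
  obtain ⟨P, hP⟩ := h.exists_point (I := {0, 1, 2, 3, 4, 5}) (by simp)
  obtain ⟨Q, hQ⟩ := h.exists_point (I := {0, 6, 7}) (by simp)
  set l : Fin 9 → Fin 3 → ℂ := fun i => (L i).rep with hl
  have hne : ∀ {i j}, i ≠ j → ∀ c : ℂ, l i ≠ c • l j := fun hij c => h.rep_ne_smul hij c
  have hl0 : ∀ i, l i ≠ 0 := fun i => (L i).rep_nonzero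
  have hPl : ∀ i, i ∈ ({0, 1, 2, 3, 4, 5} : Finset (Fin 9)) ↔ l i ⬝ᵥ P.rep = 0 := hP
  have hQl : ∀ i, i ∈ ({0, 6, 7} : Finset (Fin 9)) ↔ l i ⬝ᵥ Q.rep = 0 := hQ
  have P6 : l 6 ⬝ᵥ P.rep ≠ 0 := fun e => absurd ((hPl 6).2 e) (by decide)
  have P8 : l 8 ⬝ᵥ P.rep ≠ 0 := fun e => absurd ((hPl 8).2 e) (by decide)
  have Q8 : l 8 ⬝ᵥ Q.rep ≠ 0 := fun e => absurd ((hQl 8).2 e) (by decide)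
  have P0 := (hPl 0).1 (by decide)
  have Q0 := (hQl 0).1 (by decide)
  have Q6 := (hQl 6).1 (by decide)
  have Q7 := (hQl 7).1 (by decide)
  obtain ⟨α, β, h7⟩ := exists_combination_of_dotProduct_eq_zero Q.rep_nonzero Q0 Q6 Q7 (hl0 0)
    (hne (by decide))
  have hα : α ≠ 0 := by
    rintro rfl
    exact hne (i := 7) (j := 6) (by decide) β (by rw [h7, zero_smul, zero_add])
  have hβ : β ≠ 0 := by
    rintro rfl
    exact hne (i := 7) (j := 0) (by decide) α (by rw [h7, zero_smul, add_zero])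
  -- The scales are chosen so that the relation among the three lines of the triple point becomes `l
  -- 7 = ey - ez`.
  obtain ⟨ez, hez⟩ : ∃ b, b = (-α) • l 0 := ⟨_, rfl⟩
  obtain ⟨ey, hey⟩ : ∃ b, b = β • l 6 := ⟨_, rfl⟩
  have h7' : l 7 = ey - ez := by rw [h7, hez, hey]; module
  -- With this factor `ey - c • l 8` vanishes at `P`, so it can serve as the second generator `ex`
  -- of the pencil through `P`.
  obtain ⟨c, hc⟩ : ∃ b, b = (ey ⬝ᵥ P.rep) / (l 8 ⬝ᵥ P.rep) := ⟨_, rfl⟩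
  have yP : ey ⬝ᵥ P.rep ≠ 0 := by
    rw [hey, smul_dotProduct]; exact mul_ne_zero hβ P6
  have hc0 : c ≠ 0 := hc ▸ div_ne_zero yP P8
  obtain ⟨ex, hex⟩ : ∃ b, b = ey - c • l 8 := ⟨_, rfl⟩
  have h8' : c • l 8 = ey - ex := by rw [hex]; abel
  have xP : ex ⬝ᵥ P.rep = 0 := by
    rw [hex, sub_dotProduct, smul_dotProduct, hc, smul_eq_mul, div_mul_cancel₀ _ P8, sub_self]
  have zP : ez ⬝ᵥ P.rep = 0 := by rw [hez, smul_dotProduct, P0, smul_zero]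
  have zQ : ez ⬝ᵥ Q.rep = 0 := by rw [hez, smul_dotProduct, Q0, smul_zero]
  have yQ : ey ⬝ᵥ Q.rep = 0 := by rw [hey, smul_dotProduct, Q6, smul_zero]
  have xQ : ex ⬝ᵥ Q.rep ≠ 0 := by
    rw [hex, sub_dotProduct, yQ, zero_sub, smul_dotProduct]
    exact neg_ne_zero.2 (mul_ne_zero hc0 Q8)
  have hez0 : ez ≠ 0 := hez ▸ smul_ne_zero (neg_ne_zero.2 hα) (hl0 0)
  have hind : Independent ex ey ez := by
    intro a b d e
    have e1 := congrArg (· ⬝ᵥ Q.rep) e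
    have e2 := congrArg (· ⬝ᵥ P.rep) e
    simp only [add_dotProduct, smul_dotProduct, zQ, yQ, xP, zP, mul_zero, add_zero, zero_add,
      zero_dotProduct, smul_eq_mul, mul_eq_zero] at e1 e2
    have ha := e1.resolve_right xQ
    have hb := e2.resolve_right yP
    rw [ha, hb, zero_smul, zero_smul, zero_add, zero_add] at e
    exact ⟨ha, hb, (smul_eq_zero.1 e).resolve_right hez0⟩
  have hzx : ∀ d : ℂ, ex ≠ d • ez := by
    intro d e
    apply xQ
    rw [e, smul_dotProduct, zQ, smul_zero]
  have hfib : ∀ i ∈ ({1, 2, 3, 4, 5} : Finset (Fin 9)), ∃ s a : ℂ, s ≠ 0 ∧ l i = s • (ex - a • ez) := by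
    intro i hi
    have hi' : i ∈ ({0, 1, 2, 3, 4, 5} : Finset (Fin 9)) ∧ i ≠ 0 := by
      revert hi; revert i; decide
    obtain ⟨s, t, e⟩ := exists_combination_of_dotProduct_eq_zero P.rep_nonzero zP xP
      ((hPl i).1 hi'.1) hez0 hzx
    have ht : t ≠ 0 := by
      rintro rfl
      apply hne hi'.2 (s * -α)
      rw [e, hez, zero_smul, add_zero, smul_smul]
    refine ⟨t, -(s / t), ht, ?_⟩
    rw [e, smul_sub, smul_smul, mul_neg, mul_div_cancel₀ _ ht]
    module
  choose! s a hs hsa using hfib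
  -- The parameter of index `i` belongs to the line of index `i + 1`.
  have hcast : ∀ i : Fin 5, (i.succ.castLE (by decide) : Fin 9) ∈ ({1, 2, 3, 4, 5} : Finset (Fin 9)) := by
    decide
  -- The line of index `8` lies in no block, so it passes through no triple point; this excludes `a
  -- i = 0` and `a i = 1`.
  have hconc : ∀ i ∈ ({1, 2, 3, 4, 5} : Finset (Fin 9)), ∀ j ∈ ({6, 7} : Finset (Fin 9)),
      ¬ ∃ v : Fin 3 → ℂ, v ≠ 0 ∧ l i ⬝ᵥ v = 0 ∧ l j ⬝ᵥ v = 0 ∧ l 8 ⬝ᵥ v = 0 := by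
    rintro i hi j hj ⟨v, hv, h1, h2, h3⟩
    obtain ⟨I, hI, hiI, hjI, h8I⟩ := h.exists_block hv (i := i) (j := j) (k := 8)
      (by clear h1 h2; decide +revert) (by clear h1; decide +revert)
      (by clear h2; decide +revert) h1 h2 h3
    simp only [Finset.mem_insert, Finset.mem_singleton] at hI
    rcases hI with rfl | rfl
    · exact absurd h8I (by decide)
    · exact absurd h8I (by decide)
  have l8 : ∀ v, ey ⬝ᵥ v = ex ⬝ᵥ v → l 8 ⬝ᵥ v = 0 := by
    intro v e
    have := congrArg (· ⬝ᵥ v) h8'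
    simp only [smul_dotProduct, sub_dotProduct, e, sub_self, smul_eq_mul, mul_eq_zero] at this
    exact this.resolve_left hc0
  refine ⟨ex, ey, ez, fun i => a (i.succ.castLE (by decide)), hind, ?_, ?_, ?_, ?_⟩
  · intro i j hij
    by_contra hne'
    have hi := hsa _ (hcast i)
    have hj := hsa _ (hcast j)
    have hij' : a (i.succ.castLE (by decide) : Fin 9) = a (j.succ.castLE (by decide) : Fin 9) := hij
    refine hne (i := i.succ.castLE (by decide)) (j := j.succ.castLE (by decide)) ?_
      (s (i.succ.castLE (by decide)) / s (j.succ.castLE (by decide))) ?_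
    · intro e
      apply hne'
      simpa [Fin.ext_iff] using e
    · rw [hi, hj, hij', smul_smul, div_mul_cancel₀ _ (hs _ (hcast j))]
  · intro i hi
    replace hi : a (i.succ.castLE (by decide) : Fin 9) = 0 := hi
    -- The point `ex = ey = 0` would lie on the fibre, on `l 6` and on `l 8`.
    obtain ⟨v, hv, hxv, hyv⟩ := exists_ne_zero_orthogonal_pair ex ey
    refine hconc _ (hcast i) 6 (by decide) ⟨v, hv, ?_, ?_, l8 v (by rw [hxv, hyv])⟩
    · rw [hsa _ (hcast i), hi, zero_smul, sub_zero, smul_dotProduct, hxv, smul_zero]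
    · rw [hey, smul_dotProduct, smul_eq_mul, mul_eq_zero] at hyv
      exact hyv.resolve_left hβ
  · intro i hi
    replace hi : a (i.succ.castLE (by decide) : Fin 9) = 1 := hi
    -- The point `ex = ey = ez` would lie on the fibre, on `l 7` and on `l 8`.
    obtain ⟨v, hv, h1, h2⟩ := exists_ne_zero_orthogonal_pair (ey - ez) (ey - ex)
    rw [sub_dotProduct, sub_eq_zero] at h1 h2
    refine hconc _ (hcast i) 7 (by decide) ⟨v, hv, ?_, ?_, l8 v h2⟩
    · rw [hsa _ (hcast i), hi, one_smul, smul_dotProduct, sub_dotProduct, ← h1, ← h2, sub_self,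
        smul_zero]
    · rw [h7', sub_dotProduct, h1, sub_self]
  · intro i
    match i with
    | 0 => exact ⟨(-α)⁻¹, by
        change l 0 = (-α)⁻¹ • ez
        rw [hez, inv_smul_smul₀ (neg_ne_zero.2 hα)]⟩
    | 1 => exact ⟨_, hsa 1 (by decide)⟩
    | 2 => exact ⟨_, hsa 2 (by decide)⟩
    | 3 => exact ⟨_, hsa 3 (by decide)⟩
    | 4 => exact ⟨_, hsa 4 (by decide)⟩
    | 5 => exact ⟨_, hsa 5 (by decide)⟩
    | 6 => exact ⟨β⁻¹, by
        change l 6 = β⁻¹ • ey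
        rw [hey, inv_smul_smul₀ hβ]⟩
    | 7 => exact ⟨1, by rw [one_smul]; exact h7'⟩
    | 8 => exact ⟨c⁻¹, by
        change l 8 = c⁻¹ • (ey - ex)
        rw [← h8', inv_smul_smul₀ hc0]⟩

theorem crContractible_of_hasConfiguration {L : Fin 9 → PlaneLine}
    (h : HasConfiguration L {{0, 1, 2, 3, 4, 5}, {0, 6, 7}}) :
    CrContractible (unionOfLines L) := by
  obtain ⟨ex, ey, ez, a, hind, ha, ha0, ha1, hL⟩ := exists_normalLines h
  obtain ⟨γ, hγ⟩ := exists_cremonaMap_normalLines hind ha ha0 ha1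
  refine ⟨γ, fun p hp hpG => ?_⟩
  obtain ⟨i, -, hi⟩ := hp.prime.exists_mem_finset_dvd hpG
  obtain ⟨c, hc⟩ := hL i
  have hc0 : c ≠ 0 := by
    rintro rfl
    exact (L i).rep_nonzero (by rw [hc, zero_smul])
  have e : (L i).equation = C c * linForm (normalLines ex ey ez a i) := by
    rw [← linForm_smul, ← hc]; rfl
  rw [e, ((isUnit_iff_ne_zero.2 hc0).map C).dvd_mul_left] at hi
  exact γ.contracts_of_dvd (hi.trans (hγ i).1) (hi.trans (hγ i).2)

end Incidence

/-! ### The adjoint system of the other configuration -/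

section Adjoint

lemma HasMultiplicityAtLeast.mul {F G : MvPolynomial (Fin 3) ℂ} {P : Plane} {k l : ℕ}
    (hF : HasMultiplicityAtLeast F P k) (hG : HasMultiplicityAtLeast G P l) :
    HasMultiplicityAtLeast (F * G) P (k + l) := by
  rw [HasMultiplicityAtLeast, pow_add]
  exact Ideal.mul_mem_mul hF hG

lemma HasMultiplicityAtLeast.mono {F : MvPolynomial (Fin 3) ℂ} {P : Plane} {k l : ℕ}
    (hF : HasMultiplicityAtLeast F P k) (h : l ≤ k) : HasMultiplicityAtLeast F P l :=
  Ideal.pow_le_pow_right h hF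

lemma HasMultiplicityAtLeast.zero (F : MvPolynomial (Fin 3) ℂ) (P : Plane) :
    HasMultiplicityAtLeast F P 0 := by simp [HasMultiplicityAtLeast]

lemma hasMultiplicityAtLeast_linForm {u : Fin 3 → ℂ} {P : Plane} (h : u ⬝ᵥ P.rep = 0) :
    HasMultiplicityAtLeast (linForm u) P 1 := by
  rw [HasMultiplicityAtLeast, pow_one, RingHom.mem_ker, eval_linForm, h]

lemma hasMultiplicityAtLeast_prod {d : ℕ} (u : Fin d → Fin 3 → ℂ) {P : Plane} (s : Finset (Fin d))
    (h : ∀ i ∈ s, u i ⬝ᵥ P.rep = 0) : HasMultiplicityAtLeast (∏ i ∈ s, linForm (u i)) P s.card := by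
  classical
  induction s using Finset.induction_on with
  | empty => simpa using HasMultiplicityAtLeast.zero 1 P
  | insert i s hi ih =>
    rw [Finset.prod_insert hi, Finset.card_insert_of_notMem hi, add_comm]
    exact (hasMultiplicityAtLeast_linForm (h i (Finset.mem_insert_self _ _))).mul
      (ih fun j hj => h j (Finset.mem_insert_of_mem hj))

lemma HasConfiguration.exists_eq_of_three_le {d : ℕ} {L : Fin d → PlaneLine}
    {B : Finset (Finset (Fin d))} (h : HasConfiguration L B) {P : Plane}
    (hP : 3 ≤ lineMultiplicity L P) :
    ∃ I ∈ B, I.card = lineMultiplicity L P ∧ ∀ i, i ∈ I ↔ (L i).rep ⬝ᵥ P.rep = 0 := by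
  classical
  set I := Finset.univ.filter fun i => (L i).Through P with hI
  have hcard : I.card = lineMultiplicity L P := by
    rw [lineMultiplicity, ← Set.ncard_coe_finset]
    congr 1
    ext i; simp [hI]
  exact ⟨I, (h.2 I).2 ⟨hcard ▸ hP, P, fun i => by simp [hI]⟩, hcard, fun i => by
    simp [hI, through_iff]⟩

theorem adjointSystem_nonempty_of_hasConfiguration {L : Fin 9 → PlaneLine}
    (h : HasConfiguration L {{0, 1, 2, 3, 4, 5}, {6, 7, 8}}) : (adjointSystem 2 3 L).Nonempty := by
  classical
  obtain ⟨P, hP⟩ := h.exists_point (I := {0, 1, 2, 3, 4, 5}) (by simp)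
  obtain ⟨Q, hQ⟩ := h.exists_point (I := {6, 7, 8}) (by simp)
  obtain ⟨m, hm0, hmP, hmQ⟩ := exists_ne_zero_orthogonal_pair P.rep Q.rep
  rw [dotProduct_comm] at hmP hmQ
  set A : Finset (Fin 9) := {0, 1, 2, 3, 4, 5} with hA
  -- The six lines of the 6-fold point and three times the joining line `m`: degree `6 + 3 = 2 * 9 -
  -- 3 * 3`.
  set F := (∏ i ∈ A, linForm (L i).rep) * linForm m ^ 3 with hF
  have hpow : ∀ {R : Plane}, m ⬝ᵥ R.rep = 0 → HasMultiplicityAtLeast (linForm m ^ 3) R 3 := by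
    intro R hR
    have := hasMultiplicityAtLeast_linForm hR
    rw [HasMultiplicityAtLeast, pow_one] at this
    exact Ideal.pow_mem_pow this 3
  have hprod : ∀ (R : Plane) (I : Finset (Fin 9)), (∀ i ∈ I, (L i).rep ⬝ᵥ R.rep = 0) → I ⊆ A →
      HasMultiplicityAtLeast (∏ i ∈ A, linForm (L i).rep) R I.card := by
    intro R I hI hIA
    rw [← Finset.prod_sdiff hIA]
    have := (HasMultiplicityAtLeast.zero (∏ i ∈ A \ I, linForm (L i).rep) R).mul
      (hasMultiplicityAtLeast_prod (fun i => (L i).rep) I hI)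
    rwa [zero_add] at this
  refine ⟨F, ?_, ⟨9, by norm_num, ?_⟩, fun R => ?_⟩
  · exact mul_ne_zero (Finset.prod_ne_zero_iff.2 fun i _ => linForm_eq_zero.not.2 (L i).rep_nonzero)
      (pow_ne_zero 3 (linForm_eq_zero.not.2 hm0))
  · have h1 := IsHomogeneous.prod A (fun i => linForm (L i).rep) (fun _ => 1)
      fun i _ => linForm_isHomogeneous _
    have h2 := (linForm_isHomogeneous m).pow 3
    exact h1.mul h2
  · by_cases h3 : 3 ≤ lineMultiplicity L R
    · obtain ⟨I, hI, hcard, hIR⟩ := h.exists_eq_of_three_le h3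
      -- Two distinct lines through `S` also pass through `R`, so every line through `S` does, in
      -- particular `m`; no identification of `R` with `S` is needed.
      have same : ∀ {S : Plane} {i j : Fin 9}, i ≠ j → (L i).rep ⬝ᵥ S.rep = 0 →
          (L j).rep ⬝ᵥ S.rep = 0 → (L i).rep ⬝ᵥ R.rep = 0 → (L j).rep ⬝ᵥ R.rep = 0 →
          m ⬝ᵥ S.rep = 0 → m ⬝ᵥ R.rep = 0 := by
        intro S i j hij h1 h2 h3 h4 h5
        obtain ⟨α, β, e⟩ := exists_combination_of_dotProduct_eq_zero S.rep_nonzero h1 h2 h5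
          (L i).rep_nonzero (h.rep_ne_smul hij.symm)
        rw [e, add_dotProduct, smul_dotProduct, smul_dotProduct, h3, h4, smul_zero, smul_zero,
          add_zero]
      simp only [Finset.mem_insert, Finset.mem_singleton] at hI
      rw [← hcard]
      -- The 6-fold point gets `6 + 3 = 2 * 6 - 3`; at the triple point `m ^ 3` alone gives `3 = 2 *
      -- 3 - 3`.
      rcases hI with rfl | rfl
      · have hmR := same (S := P) (i := 0) (j := 1) (by decide) ((hP 0).1 (by decide))
          ((hP 1).1 (by decide)) ((hIR 0).1 (by decide)) ((hIR 1).1 (by decide)) hmP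
        exact ((hprod R A (fun i hi => (hIR i).1 hi) subset_rfl).mul (hpow hmR)).mono (by decide)
      · have hmR := same (S := Q) (i := 6) (j := 7) (by decide) ((hQ 6).1 (by decide))
          ((hQ 7).1 (by decide)) ((hIR 6).1 (by decide)) ((hIR 7).1 (by decide)) hmQ
        exact ((HasMultiplicityAtLeast.zero _ R).mul (hpow hmR)).mono (by decide)
    · by_cases h2 : lineMultiplicity L R = 2
      · rw [h2]
        obtain ⟨i, j, hij, e⟩ := Set.ncard_eq_two.1 h2
        have hiR : (L i).rep ⬝ᵥ R.rep = 0 := through_iff.1 (e ▸ Set.mem_insert i {j} :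
          i ∈ {i | (L i).Through R})
        have hjR : (L j).rep ⬝ᵥ R.rep = 0 := through_iff.1 (e ▸ Set.mem_insert_of_mem i rfl :
          j ∈ {i | (L i).Through R})
        -- A point on two of the lines `6`, `7`, `8` lies on the third as well, since these belong
        -- to one pencil. Hence a node lies on one of the six lines.
        have key : ∃ k ∈ A, (L k).rep ⬝ᵥ R.rep = 0 := by
          by_contra! hcon
          have hi : i ∈ ({6, 7, 8} : Finset (Fin 9)) := by
            have : i ∉ A := fun hi => hcon i hi hiR
            revert this; clear * -; revert i; decide
          have hj : j ∈ ({6, 7, 8} : Finset (Fin 9)) := by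
            have : j ∉ A := fun hj => hcon j hj hjR
            revert this; clear * -; revert j; decide
          obtain ⟨k, hk, hki, hkj⟩ : ∃ k ∈ ({6, 7, 8} : Finset (Fin 9)), k ≠ i ∧ k ≠ j := by
            revert hi hj; clear * -; revert i j; decide
          obtain ⟨α, β, e'⟩ := exists_combination_of_dotProduct_eq_zero Q.rep_nonzero
            ((hQ i).1 hi) ((hQ j).1 hj) ((hQ k).1 hk) (L i).rep_nonzero (h.rep_ne_smul hij.symm)
          have hkR : (L k).Through R := through_iff.2 (by
            rw [e', add_dotProduct, smul_dotProduct, smul_dotProduct, hiR, hjR, smul_zero,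
              smul_zero, add_zero])
          have : k ∈ ({i, j} : Set (Fin 9)) := e ▸ hkR
          rcases this with h | h
          exacts [hki h, hkj h]
        obtain ⟨k, hk, hkR⟩ := key
        have := hprod R {k} (by simpa using hkR) (by simpa using hk)
        exact (this.mul (HasMultiplicityAtLeast.zero _ R)).mono (by simp)
      -- The multiplicity is at most `1`, and truncated subtraction leaves no condition.
      · have : 2 * lineMultiplicity L R - 3 = 0 := by omega
        rw [this]
        exact HasMultiplicityAtLeast.zero _ _

end Adjoint

theorem mainTheorem7 :
    (∀ L : Fin 9 → PlaneLine,
      HasConfiguration L {{0, 1, 2, 3, 4, 5}, {0, 6, 7}} → CrContractible (unionOfLines L)) ∧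
    (∀ L : Fin 9 → PlaneLine,
      HasConfiguration L {{0, 1, 2, 3, 4, 5}, {6, 7, 8}} → (adjointSystem 2 3 L).Nonempty) :=
  ⟨fun _ => crContractible_of_hasConfiguration, fun _ => adjointSystem_nonempty_of_hasConfiguration⟩
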